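/- Work with $\mathbb{Z}$-graded supermanifolds: spaces with a sheaf $C^\infty$ of graded algebras locally isomorphic to $C^\infty(U)[\xi]$, i.e. smooth functions on an open $U\subseteq\mathbb{R}^{p_0}$ with finitely many polynomial, graded-commuting coordinates adjoined in each nonzero degree. A vector field on a supermanifold $\mathcal{M}$ is an element of $\mathfrak{X}(\mathcal{M})=\bigoplus_{j\in\mathbb{Z}}\mathfrak{X}_j(\mathcal{M})$, where $\mathfrak{X}_j(\mathcal{M})$ is the space of degree $j$ derivations of the sheaf $C^\infty(\mathcal{M})$. For a morphism $\mu:\mathcal{M}\to\mathcal{N}$, vector fields $\phi\in\mathfrak{X}(\mathcal{M})$ and $\psi\in\mathfrak{X}(\mathcal{N})$ are $\mu$-related if $\mu^*(\psi f)=\phi(\mu^* f)$ for all functions $f$ on $\mathcal{N}$. The bundle $\bigoplus_j [j]T\mathcal{M}\to\mathcal{M}$ is understood through its functor of points: a morphism $\mathcal{S}\to\bigoplus_j [j]T\mathcal{M}$ is a morphism $f:\mathcal{S}\to\mathcal{M}$ together with a finite sum of homogeneous derivations $C^\infty(\mathcal{M})\to C^\infty(\mathcal{S})$ along $f^*$.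 It is functorial in $\mathcal{M}$, and a vector field on $\mathcal{M}$ is the same as a section $\mathcal{M}\to\bigoplus_j[j]T\mathcal{M}$. Let $\mathcal{G}\rightrightarrows\mathcal{M}$ be a supergroupoid, i.e. a groupoid object in supermanifolds whose source and target $s,t$ are surjective submersions, with multiplication $m$ defined on the fibre product $\mathcal{G}^{(2)}=\mathcal{G}\,{}_s\!\times_t\,\mathcal{G}$, and let $p_1,p_2:\mathcal{G}^{(2)}\to\mathcal{G}$ be the projections. Then: (a) The tangent maps of the structure maps of $\mathcal{G}$ make $\bigoplus_j[j]T\mathcal{G}\rightrightarrows\bigoplus_j[j]T\mathcal{M}$ a groupoid object (in functors of points on supermanifolds), whose object of composable pairs is $\bigoplus_j[j]T\mathcal{G}^{(2)}$. (b) For every vector field $\psi\in\mathfrak{X}(\mathcal{G})$ the following are equivalent: (i) $\psi$ is multiplicative, i.e. there is a vector field $\psi^{(2)}$ on $\mathcal{G}^{(2)}$ that is $p_1$-, $p_2$- and $m$-related to $\psi$; (ii) $\psi$, as a section $\mathcal{G}\to\bigoplus_j[j]T\mathcal{G}$, is a morphism of groupoids, i.e. there is a map $\psi^{(0)}:\mathcal{M}\to\bigoplus_j[j]T\mathcal{M}$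 over which $\psi$ commutes with source, target, multiplication, units and inverses. -/

import Mathlib

open CategoryTheory TopologicalSpace Opposite
open scoped Manifold ContDiff DirectSum

noncomputable section

/-! ## Coordinate superspaces -/

/-- Coordinates of nonzero degree on the coordinate superspace of dimension `p`: for every `i ≠ 0`
there are `p i` of them, each of degree `-i`. -/
abbrev SuperCoord (p : ℤ → ℕ) : Type := Σ i : {i : ℤ // i ≠ 0}, Fin (p i.1)

/-- The degree of a coordinate. -/
def SuperCoord.degree {p : ℤ → ℕ} (a : SuperCoord p) : ℤ := -a.1.1

/-- The body `ℝ^{p₀}` of the coordinate superspace. -/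
abbrev Body (p : ℤ → ℕ) : Type := EuclideanSpace ℝ (Fin (p 0))

/-- Ordinary real-valued smooth functions on an open subset of the body. -/
abbrev BodyFun (p : ℤ → ℕ) (W : Opens (Body p)) : Type :=
  C^∞⟮𝓘(ℝ, Body p), W; ℝ⟯

/-- The commutation rule `ξ η = (-1)^{|ξ||η|} η ξ` between coordinates. -/
inductive SuperRel (p : ℤ → ℕ) (W : Opens (Body p)) :
    FreeAlgebra (BodyFun p W) (SuperCoord p) → FreeAlgebra (BodyFun p W) (SuperCoord p) → Prop
  | comm (a b : SuperCoord p) :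
      SuperRel p W (FreeAlgebra.ι _ a * FreeAlgebra.ι _ b)
        (((a.degree * b.degree).negOnePow : ℤ) • (FreeAlgebra.ι _ b * FreeAlgebra.ι _ a))

/-- The algebra `C^∞(W)[ξ]`: polynomials, with coefficients in the smooth functions on `W`, in the
graded-commuting coordinates of nonzero degree. -/
abbrev SuperFun (p : ℤ → ℕ) (W : Opens (Body p)) : Type := RingQuot (SuperRel p W)

/-- A smooth function on `W` as an element of `C^∞(W)[ξ]`. -/
def SuperFun.ofBody {p : ℤ → ℕ} {W : Opens (Body p)} (f : BodyFun p W) : SuperFun p W :=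
  algebraMap (BodyFun p W) (SuperFun p W) f

/-- A coordinate as an element of `C^∞(W)[ξ]`. -/
def SuperFun.coord {p : ℤ → ℕ} (W : Opens (Body p)) (a : SuperCoord p) : SuperFun p W :=
  RingQuot.mkAlgHom (BodyFun p W) (SuperRel p W) (FreeAlgebra.ι _ a)

/-- Restriction of smooth functions to a smaller open set. -/
def BodyFun.res {p : ℤ → ℕ} {W W' : Opens (Body p)} (h : W' ≤ W) (f : BodyFun p W) :
    BodyFun p W' :=
  ContMDiffMap.restrictRingHom 𝓘(ℝ, Body p) 𝓘(ℝ, ℝ) ℝ h f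

/-! ## Graded spaces, charts, supermanifolds -/

/-- A topological space with a sheaf of `ℤ`-graded, graded-commutative real algebras and an
evaluation map to real-valued functions.  As usual for sheaves of graded algebras, gluing is
required in each degree separately. -/
structure GradedSpace where
  carrier : Type
  [top : TopologicalSpace carrier]
  /-- Sections over an open set. -/
  sec : Opens carrier → Type
  [ring : ∀ U, Ring (sec U)]
  [alg : ∀ U, Algebra ℝ (sec U)]
  /-- Homogeneous sections. -/
  deg : ∀ U, ℤ → Submodule ℝ (sec U)
  [gradedMonoid : ∀ U, SetLike.GradedMonoid (deg U)]
  isInternal : ∀ U, DirectSum.IsInternal (deg U)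
  graded_comm : ∀ U (i j : ℤ) (a b : sec U), a ∈ deg U i → b ∈ deg U j →
    a * b = ((i * j).negOnePow : ℤ) • (b * a)
  /-- Restriction. -/
  res : ∀ {U V : Opens carrier}, U ≤ V → (sec V →ₐ[ℝ] sec U)
  res_deg : ∀ {U V : Opens carrier} (h : U ≤ V) (i : ℤ) (a : sec V),
    a ∈ deg V i → res h a ∈ deg U i
  res_refl : ∀ (U : Opens carrier) (a : sec U), res (le_refl U) a = a
  res_res : ∀ {U V W : Opens carrier} (h : U ≤ V) (h' : V ≤ W) (a : sec W),
    res h (res h' a) = res (h.trans h') a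
  glue : ∀ {ι : Type} (U : ι → Opens carrier) (k : ℤ) (a : ∀ i, sec (U i)),
    (∀ i, a i ∈ deg (U i) k) →
    (∀ i j, res (inf_le_left : U i ⊓ U j ≤ U i) (a i) =
      res (inf_le_right : U i ⊓ U j ≤ U j) (a j)) →
    ∃! b : sec (⨆ i, U i), b ∈ deg (⨆ i, U i) k ∧ ∀ i, res (le_iSup U i) b = a i
  /-- The value of a section at the points of its domain. -/
  eval : ∀ U, sec U →ₐ[ℝ] (U → ℝ)
  eval_res : ∀ {U V : Opens carrier} (h : U ≤ V) (a : sec V) (x : U),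
    eval U (res h a) x = eval V a ⟨x.1, h x.2⟩

attribute [instance] GradedSpace.top GradedSpace.ring GradedSpace.alg GradedSpace.gradedMonoid

/-- The open subset of the chart domain that corresponds to `W`. -/
def chartPull {M : Type} [TopologicalSpace M] {p : ℤ → ℕ}
    (e : OpenPartialHomeomorph M (Body p)) (W : Opens (Body p)) : Opens M :=
  ⟨e.source ∩ e ⁻¹' W, e.isOpen_inter_preimage W.isOpen⟩

theorem chartPull_mono {M : Type} [TopologicalSpace M] {p : ℤ → ℕ}
    (e : OpenPartialHomeomorph M (Body p)) {W W' : Opens (Body p)} (h : W' ≤ W) :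
    chartPull e W' ≤ chartPull e W :=
  fun _ hx => ⟨hx.1, h hx.2⟩

/-- A chart of dimension `p`: an isomorphism between the restriction of `X` to an open set and a
superdomain of dimension `p`.  The presheaf `W ↦ C^∞(W)[ξ]` is separated but, when there are even
coordinates of both signs or infinitely many coordinates, not always a sheaf; the superdomain
carries the associated sheaf, and the isomorphism is expressed by a map from the presheaf that is
injective and locally surjective. -/
structure SuperChart (X : GradedSpace) (p : ℤ → ℕ) where
  e : OpenPartialHomeomorph X.carrier (Body p)
  toSec : ∀ W : Opens (Body p), (W : Set (Body p)) ⊆ e.target →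
    (SuperFun p W →ₐ[ℝ] X.sec (chartPull e W))
  /-- Compatibility with restriction, on the generators. -/
  res_ofBody : ∀ {W W' : Opens (Body p)} (h : W' ≤ W) (hW : (W : Set (Body p)) ⊆ e.target)
    (f : BodyFun p W),
    X.res (chartPull_mono e h) (toSec W hW (SuperFun.ofBody f)) =
      toSec W' (subset_trans h hW) (SuperFun.ofBody (BodyFun.res h f))
  res_coord : ∀ {W W' : Opens (Body p)} (h : W' ≤ W) (hW : (W : Set (Body p)) ⊆ e.target)
    (a : SuperCoord p),
    X.res (chartPull_mono e h) (toSec W hW (SuperFun.coord W a)) =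
      toSec W' (subset_trans h hW) (SuperFun.coord W' a)
  /-- Compatibility with the degrees, on the generators. -/
  deg_ofBody : ∀ W hW (f : BodyFun p W),
    toSec W hW (SuperFun.ofBody f) ∈ X.deg (chartPull e W) 0
  deg_coord : ∀ W hW (a : SuperCoord p),
    toSec W hW (SuperFun.coord W a) ∈ X.deg (chartPull e W) a.degree
  /-- Compatibility with evaluation: a smooth function is evaluated as such, and the coordinates
  of nonzero degree evaluate to zero. -/
  eval_ofBody : ∀ W hW (f : BodyFun p W) (x : chartPull e W),
    X.eval (chartPull e W) (toSec W hW (SuperFun.ofBody f)) x = f ⟨e x.1, x.2.2⟩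
  eval_coord : ∀ W hW (a : SuperCoord p) (x : chartPull e W),
    X.eval (chartPull e W) (toSec W hW (SuperFun.coord W a)) x = 0
  injective : ∀ W hW, Function.Injective (toSec W hW)
  locally_surjective : ∀ W hW (b : X.sec (chartPull e W)), ∀ x ∈ W,
    ∃ (W' : Opens (Body p)) (h : W' ≤ W), x ∈ W' ∧
      X.res (chartPull_mono e h) b ∈ Set.range (toSec W' (subset_trans h hW))

/-- A (`ℤ`-graded) supermanifold. -/
structure Supermanifold extends GradedSpace where
  exists_chart : ∃ p : ℤ → ℕ, ∀ x : carrier,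
    ∃ φ : SuperChart toGradedSpace p, x ∈ φ.e.source

namespace Supermanifold

/-- An open set `tgt` of the target and an open set `src` of the source that is mapped into it. -/
structure OpenPair {X Y : Type} [TopologicalSpace X] [TopologicalSpace Y] (f : C(X, Y)) where
  tgt : Opens Y
  src : Opens X
  le : ∀ x ∈ src, f x ∈ tgt

namespace OpenPair

variable {X Y Z : Type} [TopologicalSpace X] [TopologicalSpace Y] [TopologicalSpace Z]

/-- The pair `(V, f⁻¹ V)`. -/
abbrev full (f : C(X, Y)) (V : Opens Y) : OpenPair f := ⟨V, Opens.comap f V, fun _ hx => hx⟩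

/-- A pair for `g ∘ f` gives the pair `(V, g⁻¹ V)` for `g`, ... -/
abbrev outer {f : C(X, Y)} {g : C(Y, Z)} (q : OpenPair (g.comp f)) : OpenPair g :=
  full g q.tgt

/-- ... and the pair `(g⁻¹ V, U)` for `f`. -/
abbrev inner {f : C(X, Y)} {g : C(Y, Z)} (q : OpenPair (g.comp f)) : OpenPair f :=
  ⟨Opens.comap g q.tgt, q.src, fun x hx => q.le x hx⟩

theorem le_of_id (q : OpenPair (ContinuousMap.id X)) : q.src ≤ q.tgt := fun x hx => q.le x hx

end OpenPair

/-- A morphism of supermanifolds: a continuous map `base` together with a morphism of sheaves of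
graded algebras over it, compatible with evaluation.  The sheaf morphism is recorded as its
components from sections over `q.tgt` to sections over `q.src`, for all `q.src ⊆ base⁻¹(q.tgt)`.
Smoothness of `base` follows, since the coordinates of `base` are the evaluations of the
pullbacks of coordinate functions. -/
structure Hom (M N : Supermanifold) where
  base : C(M.carrier, N.carrier)
  pull : ∀ q : OpenPair base, N.sec q.tgt →ₐ[ℝ] M.sec q.src
  pull_deg : ∀ (q : OpenPair base) (i : ℤ) (a : N.sec q.tgt),
    a ∈ N.deg q.tgt i → pull q a ∈ M.deg q.src i
  pull_res : ∀ (q r : OpenPair base) (ht : r.tgt ≤ q.tgt) (hs : r.src ≤ q.src)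
    (a : N.sec q.tgt), pull r (N.res ht a) = M.res hs (pull q a)
  eval_pull : ∀ (q : OpenPair base) (a : N.sec q.tgt) (x : q.src),
    M.eval q.src (pull q a) x = N.eval q.tgt a ⟨base x.1, q.le x.1 x.2⟩

theorem Hom.ext' {M N : Supermanifold} {f g : Hom M N} (hb : f.base = g.base)
    (hp : ∀ (V : Opens N.carrier) (U : Opens M.carrier) (h : ∀ x ∈ U, f.base x ∈ V)
      (h' : ∀ x ∈ U, g.base x ∈ V) (a : N.sec V), f.pull ⟨V, U, h⟩ a = g.pull ⟨V, U, h'⟩ a) :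
    f = g := by
  obtain ⟨fb, fp, _, _, _⟩ := f
  obtain ⟨gb, gp, _, _, _⟩ := g
  obtain rfl : fb = gb := hb
  obtain rfl : fp = gp := by
    funext q
    ext a
    exact hp q.tgt q.src q.le q.le a
  rfl

theorem Hom.pull_res_left {M N : Supermanifold} (f : Hom M N) {V' V : Opens N.carrier}
    {U : Opens M.carrier} (ht : V' ≤ V) (h : ∀ x ∈ U, f.base x ∈ V')
    (h' : ∀ x ∈ U, f.base x ∈ V) (a : N.sec V) :
    f.pull ⟨V', U, h⟩ (N.res ht a) = f.pull ⟨V, U, h'⟩ a :=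
  (f.pull_res ⟨V, U, h'⟩ ⟨V', U, h⟩ ht le_rfl a).trans (M.res_refl _ _)

theorem Hom.res_pull {M N : Supermanifold} (f : Hom M N) {V : Opens N.carrier}
    {U' U : Opens M.carrier} (hs : U' ≤ U) (h : ∀ x ∈ U, f.base x ∈ V)
    (h' : ∀ x ∈ U', f.base x ∈ V) (a : N.sec V) :
    M.res hs (f.pull ⟨V, U, h⟩ a) = f.pull ⟨V, U', h'⟩ a := by
  rw [← f.pull_res ⟨V, U, h⟩ ⟨V, U', h'⟩ le_rfl hs a, N.res_refl]

/-- The identity morphism; its pullbacks are the restriction maps. -/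
def Hom.id (M : Supermanifold) : Hom M M where
  base := ContinuousMap.id _
  pull q := M.res q.le_of_id
  pull_deg q i a ha := M.res_deg _ i a ha
  pull_res q r ht hs a := by rw [M.res_res, M.res_res]
  eval_pull q a x := M.eval_res _ a x

/-- Composition of morphisms. -/
def Hom.comp {M N P : Supermanifold} (f : Hom M N) (g : Hom N P) : Hom M P where
  base := g.base.comp f.base
  pull q := (f.pull q.inner).comp (g.pull q.outer)
  pull_deg q i a ha := f.pull_deg q.inner i _ (g.pull_deg q.outer i a ha)
  pull_res q r ht hs a := by
    have h1 := g.pull_res q.outer r.outer ht (fun x hx => ht hx) a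
    have h2 := f.pull_res q.inner r.inner (fun x hx => ht hx) hs (g.pull q.outer a)
    exact (congrArg (f.pull r.inner) h1).trans h2
  eval_pull q a x :=
    (f.eval_pull q.inner (g.pull q.outer a) x).trans
      (g.eval_pull q.outer a ⟨f.base x.1, q.le x.1 x.2⟩)

instance : Category Supermanifold where
  Hom := Hom
  id := Hom.id
  comp := Hom.comp
  id_comp f := Hom.ext' rfl fun _ _ _ h' a => f.res_pull _ (fun _ hx => hx) h' a
  comp_id f := Hom.ext' rfl fun _ _ _ h' a => f.pull_res_left _ _ h' a
  assoc _ _ _ := Hom.ext' rfl fun _ _ _ _ _ => rfl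

/-! ## Submersions -/

/-- A tangent vector at the point `x`: a derivation, at `x`, of the germs of functions. -/
structure TangentVector (M : Supermanifold) (x : M.carrier) where
  toFun : ∀ U : Opens M.carrier, x ∈ U → M.sec U →ₗ[ℝ] ℝ
  res : ∀ {U V : Opens M.carrier} (h : U ≤ V) (hx : x ∈ U) (a : M.sec V),
    toFun U hx (M.res h a) = toFun V (h hx) a
  leibniz : ∀ (U : Opens M.carrier) (hx : x ∈ U) (a b : M.sec U),
    toFun U hx (a * b) =
      toFun U hx a * M.eval U b ⟨x, hx⟩ + M.eval U a ⟨x, hx⟩ * toFun U hx b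

/-- A morphism is a submersion if all its differentials are surjective. -/
def IsSubmersion {M N : Supermanifold} (f : M ⟶ N) : Prop :=
  ∀ (x : M.carrier) (w : TangentVector N (Hom.base f x)),
    ∃ v : TangentVector M x, ∀ (q : OpenPair (Hom.base f)) (hx : x ∈ q.src) (a : N.sec q.tgt),
      v.toFun q.src hx (Hom.pull f q a) = w.toFun q.tgt (q.le x hx) a

/-! ## Vector fields -/

/-- Vector fields of degree `j`: degree `j` derivations of the sheaf of functions. -/
def VectorFieldOfDegree (M : Supermanifold) (j : ℤ) :
    Submodule ℝ (∀ U : Opens M.carrier, M.sec U →ₗ[ℝ] M.sec U) where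
  carrier := {X |
    (∀ (U V : Opens M.carrier) (h : U ≤ V) (a : M.sec V),
      X U (M.res h a) = M.res h (X V a)) ∧
    (∀ (U : Opens M.carrier) (i : ℤ) (a : M.sec U), a ∈ M.deg U i →
      X U a ∈ M.deg U (j + i)) ∧
    (∀ (U : Opens M.carrier) (i : ℤ) (a b : M.sec U), a ∈ M.deg U i →
      X U (a * b) = X U a * b + ((j * i).negOnePow : ℤ) • (a * X U b))}
  zero_mem' := by
    refine ⟨fun U V h a => ?_, fun U i a ha => ?_, fun U i a b ha => ?_⟩ <;> simp
  add_mem' := by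
    rintro X Y ⟨hX1, hX2, hX3⟩ ⟨hY1, hY2, hY3⟩
    refine ⟨fun U V h a => ?_, fun U i a ha => ?_, fun U i a b ha => ?_⟩
    · simp [hX1, hY1]
    · exact Submodule.add_mem _ (hX2 U i a ha) (hY2 U i a ha)
    · simp only [Pi.add_apply, LinearMap.add_apply, hX3 U i a b ha, hY3 U i a b ha, add_mul,
        mul_add, smul_add]
      abel
  smul_mem' := by
    rintro c X ⟨hX1, hX2, hX3⟩
    refine ⟨fun U V h a => ?_, fun U i a ha => ?_, fun U i a b ha => ?_⟩
    · simp [hX1]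
    · exact Submodule.smul_mem _ c (hX2 U i a ha)
    · simp only [Pi.smul_apply, LinearMap.smul_apply, hX3 U i a b ha, smul_add,
        smul_mul_assoc, mul_smul_comm, smul_comm c]

/-- All vector fields, `𝔛(M) = ⨁ j, 𝔛_j(M)`. -/
abbrev VectorField (M : Supermanifold) : Type := ⨁ j : ℤ, VectorFieldOfDegree M j

/-- The action of a vector field on functions. -/
def VectorField.apply {M : Supermanifold} (X : VectorField M) (U : Opens M.carrier)
    (a : M.sec U) : M.sec U :=
  DirectSum.coeLinearMap (fun j : ℤ => VectorFieldOfDegree M j) X U a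

/-- `X` on `M` and `Y` on `N` are `f`-related: `f^*(Y a) = X (f^* a)` for all functions `a`. -/
def Related {M N : Supermanifold} (f : M ⟶ N) (X : VectorField M) (Y : VectorField N) : Prop :=
  ∀ (q : OpenPair (Hom.base f)) (a : N.sec q.tgt),
    Hom.pull f q (Y.apply q.tgt a) = X.apply q.src (Hom.pull f q a)

/-! ## The bundle `⨁ j, [j]TM`, as a functor of points -/

/-- Derivations of degree `j` along a morphism `f : S ⟶ M`, that is, degree `j` derivations from
the functions on `M` to the functions on `S`, over `f^*`. -/
def DerivationAlong {S M : Supermanifold} (f : S ⟶ M) (j : ℤ) :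
    Submodule ℝ (∀ q : OpenPair (Hom.base f), M.sec q.tgt →ₗ[ℝ] S.sec q.src) where
  carrier := {X |
    (∀ (q r : OpenPair (Hom.base f)) (ht : r.tgt ≤ q.tgt) (hs : r.src ≤ q.src) (a : M.sec q.tgt),
      X r (M.res ht a) = S.res hs (X q a)) ∧
    (∀ (q : OpenPair (Hom.base f)) (i : ℤ) (a : M.sec q.tgt), a ∈ M.deg q.tgt i →
      X q a ∈ S.deg q.src (j + i)) ∧
    (∀ (q : OpenPair (Hom.base f)) (i : ℤ) (a b : M.sec q.tgt), a ∈ M.deg q.tgt i →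
      X q (a * b) = X q a * Hom.pull f q b +
        ((j * i).negOnePow : ℤ) • (Hom.pull f q a * X q b))}
  zero_mem' := by
    refine ⟨fun q r ht hs a => ?_, fun q i a ha => ?_, fun q i a b ha => ?_⟩ <;> simp
  add_mem' := by
    rintro X Y ⟨hX1, hX2, hX3⟩ ⟨hY1, hY2, hY3⟩
    refine ⟨fun q r ht hs a => ?_, fun q i a ha => ?_, fun q i a b ha => ?_⟩
    · simp [hX1 q r ht hs, hY1 q r ht hs]
    · exact Submodule.add_mem _ (hX2 q i a ha) (hY2 q i a ha)
    · simp only [Pi.add_apply, LinearMap.add_apply, hX3 q i a b ha, hY3 q i a b ha, add_mul,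
        mul_add, smul_add]
      abel
  smul_mem' := by
    rintro c X ⟨hX1, hX2, hX3⟩
    refine ⟨fun q r ht hs a => ?_, fun q i a ha => ?_, fun q i a b ha => ?_⟩
    · simp [hX1 q r ht hs]
    · exact Submodule.smul_mem _ c (hX2 q i a ha)
    · simp only [Pi.smul_apply, LinearMap.smul_apply, hX3 q i a b ha, smul_add,
        smul_mul_assoc, mul_smul_comm, smul_comm c]

/-- Pulling a derivation along `f` back by `g : S' ⟶ S`: the derivation `g^* ∘ X` along
`g ≫ f`. -/
def DerivationAlong.precomp {S' S M : Supermanifold} (g : S' ⟶ S) (f : S ⟶ M) (j : ℤ) :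
    DerivationAlong f j →ₗ[ℝ] DerivationAlong (g ≫ f) j where
  toFun X := ⟨fun q => (Hom.pull g (OpenPair.inner q)).toLinearMap ∘ₗ X.1 (OpenPair.outer q), by
    obtain ⟨X, h1, h2, h3⟩ := X
    refine ⟨fun q r ht hs a => ?_, fun q i a ha => ?_, fun q i a b ha => ?_⟩
    · exact (congrArg (Hom.pull g (OpenPair.inner r))
        (h1 (OpenPair.outer q) (OpenPair.outer r) ht (fun x hx => ht hx) a)).trans
        (Hom.pull_res g (OpenPair.inner q) (OpenPair.inner r) (fun x hx => ht hx) hs _)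
    · exact Hom.pull_deg g (OpenPair.inner q) _ _ (h2 (OpenPair.outer q) i a ha)
    · refine (congrArg (Hom.pull g (OpenPair.inner q)) (h3 (OpenPair.outer q) i a b ha)).trans ?_
      rw [map_add, map_mul, map_zsmul, map_mul]
      rfl⟩
  map_add' X Y := by
    ext q a
    exact map_add (Hom.pull g (OpenPair.inner q)) _ _
  map_smul' c X := by
    ext q a
    exact map_smul (Hom.pull g (OpenPair.inner q)) _ _

/-- Pushing a derivation along `f` forward by `h : M ⟶ N`: the derivation `X ∘ h^*` along
`f ≫ h`. -/
def DerivationAlong.postcomp {S M N : Supermanifold} (f : S ⟶ M) (h : M ⟶ N) (j : ℤ) :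
    DerivationAlong f j →ₗ[ℝ] DerivationAlong (f ≫ h) j where
  toFun X := ⟨fun q => X.1 (OpenPair.inner q) ∘ₗ (Hom.pull h (OpenPair.outer q)).toLinearMap, by
    obtain ⟨X, h1, h2, h3⟩ := X
    refine ⟨fun q r ht hs a => ?_, fun q i a ha => ?_, fun q i a b ha => ?_⟩
    · exact (congrArg (X (OpenPair.inner r))
        (Hom.pull_res h (OpenPair.outer q) (OpenPair.outer r) ht (fun x hx => ht hx) a)).trans
        (h1 (OpenPair.inner q) (OpenPair.inner r) (fun x hx => ht hx) hs _)
    · exact h2 (OpenPair.inner q) i _ (Hom.pull_deg h (OpenPair.outer q) i a ha)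
    · exact (congrArg (X (OpenPair.inner q)) (map_mul (Hom.pull h (OpenPair.outer q)) a b)).trans
        (h3 (OpenPair.inner q) i _ _ (Hom.pull_deg h (OpenPair.outer q) i a ha))⟩
  map_add' X Y := rfl
  map_smul' c X := rfl

/-- An `S`-point of `⨁ j, [j]TM`: a morphism `f : S ⟶ M` and a section over `S` of the pullback
by `f` of the bundle `⨁ j, [j]TM ⟶ M`, that is, a finite sum of homogeneous derivations along
`f`; the summand of degree `j` is the component in `[-j]TM`. -/
structure TangentPoint (M S : Supermanifold) where
  pt : S ⟶ M
  vec : ⨁ j : ℤ, DerivationAlong pt j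

theorem TangentPoint.ext' {M S : Supermanifold} {x y : TangentPoint M S} (hp : x.pt = y.pt)
    (hv : ∀ (j : ℤ) (V : Opens M.carrier) (U : Opens S.carrier)
      (h : ∀ s ∈ U, Hom.base x.pt s ∈ V) (h' : ∀ s ∈ U, Hom.base y.pt s ∈ V) (a : M.sec V),
      (x.vec j).1 ⟨V, U, h⟩ a = (y.vec j).1 ⟨V, U, h'⟩ a) : x = y := by
  obtain ⟨f, X⟩ := x
  obtain ⟨g, Y⟩ := y
  obtain rfl : f = g := hp
  obtain rfl : X = Y := by
    refine DFinsupp.ext fun j => Subtype.ext (funext fun q => LinearMap.ext fun a => ?_)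
    exact hv j q.tgt q.src q.le q.le a
  rfl

/-- Change of `S`. -/
def TangentPoint.precomp {M S' S : Supermanifold} (g : S' ⟶ S) (x : TangentPoint M S) :
    TangentPoint M S' :=
  ⟨g ≫ x.pt, DirectSum.lmap (DerivationAlong.precomp g x.pt) x.vec⟩

/-- The tangent map of `h : M ⟶ N` on `S`-points. -/
def TangentPoint.postcomp {M N S : Supermanifold} (h : M ⟶ N) (x : TangentPoint M S) :
    TangentPoint N S :=
  ⟨x.pt ≫ h, DirectSum.lmap (DerivationAlong.postcomp x.pt h) x.vec⟩

/-- The total space of `⨁ j, [j]TM ⟶ M`, given by its functor of points. -/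
def tangentBundle (M : Supermanifold) : Supermanifoldᵒᵖ ⥤ Type where
  obj S := TangentPoint M S.unop
  map g := TypeCat.ofHom (TangentPoint.precomp g.unop)
  map_id S := by
    ext x
    refine TangentPoint.ext' (Category.id_comp _) fun j V U h h' a => ?_
    exact ((x.vec j).2.1 (OpenPair.full _ V) ⟨V, U, h'⟩ le_rfl h' a).symm.trans
      (congrArg _ (M.res_refl V a))
  map_comp g g' := by
    ext x
    exact TangentPoint.ext' (Category.assoc _ _ _) fun j V U h h' a => rfl

/-- The functor `M ↦ ⨁ j, [j]TM`. -/
def tangentFunctor : Supermanifold ⥤ (Supermanifoldᵒᵖ ⥤ Type) where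
  obj := tangentBundle
  map h :=
    { app := fun _ => TypeCat.ofHom (TangentPoint.postcomp h)
      naturality := fun _ _ g => by
        ext x
        exact TangentPoint.ext' (Category.assoc _ _ _) fun j V U h h' a => rfl }
  map_id M := by
    ext S x
    refine TangentPoint.ext' (x := TangentPoint.postcomp (𝟙 M) x) (y := x)
      (Category.comp_id _) fun j V U h h' a => ?_
    refine ((x.vec j).2.1 ⟨V, U, h'⟩ _ le_rfl le_rfl a).trans ?_
    exact S.unop.res_refl _ _
  map_comp h k := by
    ext S x
    exact TangentPoint.ext' (Category.assoc _ _ _).symm fun j V U h h' a => rfl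

/-- A vector field of degree `j` as a derivation along the identity. -/
def VectorFieldOfDegree.along (M : Supermanifold) (j : ℤ) :
    VectorFieldOfDegree M j →ₗ[ℝ] DerivationAlong (𝟙 M) j where
  toFun X := ⟨fun q => (M.res (OpenPair.le_of_id q)).toLinearMap ∘ₗ X.1 q.tgt, by
    obtain ⟨X, h1, h2, h3⟩ := X
    refine ⟨fun q r ht hs a => ?_, fun q i a ha => ?_, fun q i a b ha => ?_⟩
    · simp only [LinearMap.comp_apply, AlgHom.toLinearMap_apply]
      rw [h1, M.res_res, M.res_res]
    · exact M.res_deg _ _ _ (h2 _ i a ha)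
    · simp only [LinearMap.comp_apply, AlgHom.toLinearMap_apply]
      rw [h3 _ i a b ha, map_add, map_mul, map_zsmul, map_mul]
      rfl⟩
  map_add' X Y := by
    ext q a
    exact map_add (M.res (OpenPair.le_of_id q)) _ _
  map_smul' c X := by
    ext q a
    exact map_smul (M.res (OpenPair.le_of_id q)) _ _

/-- A vector field on `M` as a morphism `M ⟶ ⨁ j, [j]TM`, a section of the bundle projection. -/
def VectorField.toSection {M : Supermanifold} (X : VectorField M) :
    yoneda.obj M ⟶ tangentFunctor.obj M :=
  yonedaEquiv.symm <| show TangentPoint M M from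
    ⟨𝟙 M, DirectSum.lmap (VectorFieldOfDegree.along M) X⟩

end Supermanifold

/-! ## Groupoid objects -/

universe v u v' u'

/-- Structure maps of a groupoid object: `comp` is the object of composable pairs. -/
structure GroupoidData (C : Type u) [Category.{v} C] where
  ob : C
  mor : C
  comp : C
  s : mor ⟶ ob
  t : mor ⟶ ob
  p₁ : comp ⟶ mor
  p₂ : comp ⟶ mor
  composable : p₁ ≫ s = p₂ ≫ t
  m : comp ⟶ mor
  e : ob ⟶ mor
  i : mor ⟶ mor

/-- The axioms of a groupoid object.  A composable pair `(g, h)` has `s(g) = t(h)`, and its product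
has source `s(h)` and target `t(g)`. -/
structure GroupoidData.IsGroupoid {C : Type u} [Category.{v} C] (G : GroupoidData C) : Prop where
  isPullback : IsPullback G.p₁ G.p₂ G.s G.t
  m_s : G.m ≫ G.s = G.p₂ ≫ G.s
  m_t : G.m ≫ G.t = G.p₁ ≫ G.t
  e_s : G.e ≫ G.s = 𝟙 G.ob
  e_t : G.e ≫ G.t = 𝟙 G.ob
  i_s : G.i ≫ G.s = G.t
  i_t : G.i ≫ G.t = G.s
  assoc : ∀ {T : C} (a b c : T ⟶ G.mor) (hab : a ≫ G.s = b ≫ G.t) (hbc : b ≫ G.s = c ≫ G.t),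
    isPullback.lift (isPullback.lift a b hab ≫ G.m) c
        (by rw [Category.assoc, m_s, isPullback.lift_snd_assoc, hbc]) ≫ G.m =
      isPullback.lift a (isPullback.lift b c hbc ≫ G.m)
        (by rw [Category.assoc, m_t, isPullback.lift_fst_assoc, hab]) ≫ G.m
  e_m : isPullback.lift (G.t ≫ G.e) (𝟙 G.mor)
    (by rw [Category.assoc, e_s, Category.comp_id, Category.id_comp]) ≫ G.m = 𝟙 G.mor
  m_e : isPullback.lift (𝟙 G.mor) (G.s ≫ G.e)
    (by rw [Category.assoc, e_t, Category.comp_id, Category.id_comp]) ≫ G.m = 𝟙 G.mor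
  i_m : isPullback.lift G.i (𝟙 G.mor) (by rw [i_s, Category.id_comp]) ≫ G.m = G.s ≫ G.e
  m_i : isPullback.lift (𝟙 G.mor) G.i (by rw [i_t, Category.id_comp]) ≫ G.m = G.t ≫ G.e

/-- The image of the structure maps under a functor. -/
def GroupoidData.map {C : Type u} [Category.{v} C] {D : Type u'} [Category.{v'} D]
    (G : GroupoidData C) (F : C ⥤ D) : GroupoidData D where
  ob := F.obj G.ob
  mor := F.obj G.mor
  comp := F.obj G.comp
  s := F.map G.s
  t := F.map G.t
  p₁ := F.map G.p₁
  p₂ := F.map G.p₂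
  composable := by rw [← F.map_comp, ← F.map_comp, G.composable]
  m := F.map G.m
  e := F.map G.e
  i := F.map G.i

/-- `φ` is a morphism of groupoids: over some map `φ₀` of the objects it commutes with source,
target, multiplication, units and inverses. -/
def GroupoidData.IsMorphism {C : Type u} [Category.{v} C] (G H : GroupoidData C)
    (hH : H.IsGroupoid) (φ : G.mor ⟶ H.mor) : Prop :=
  ∃ (φ₀ : G.ob ⟶ H.ob) (hs : φ ≫ H.s = G.s ≫ φ₀) (ht : φ ≫ H.t = G.t ≫ φ₀),
    hH.isPullback.lift (G.p₁ ≫ φ) (G.p₂ ≫ φ)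
      (by rw [Category.assoc, Category.assoc, hs, ht, ← Category.assoc, ← Category.assoc,
        G.composable]) ≫ H.m = G.m ≫ φ ∧
    G.e ≫ φ = φ₀ ≫ H.e ∧
    G.i ≫ φ = φ ≫ H.i

/-- A supergroupoid: a groupoid object in supermanifolds whose source and target maps are
surjective submersions. -/
structure Supergroupoid extends GroupoidData Supermanifold where
  isGroupoid : toGroupoidData.IsGroupoid
  s_surjective : Function.Surjective (Supermanifold.Hom.base s)
  t_surjective : Function.Surjective (Supermanifold.Hom.base t)
  s_submersion : Supermanifold.IsSubmersion s
  t_submersion : Supermanifold.IsSubmersion t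

namespace Supergroupoid

/-- The groupoid `𝒢` itself, seen through its functor of points. -/
def points (𝒢 : Supergroupoid) : GroupoidData (Supermanifoldᵒᵖ ⥤ Type) :=
  𝒢.toGroupoidData.map yoneda

/-- The structure maps of `⨁ j, [j]T𝒢 ⇉ ⨁ j, [j]Tℳ`: the tangent maps of those of `𝒢 ⇉ ℳ`. -/
def tangent (𝒢 : Supergroupoid) : GroupoidData (Supermanifoldᵒᵖ ⥤ Type) :=
  𝒢.toGroupoidData.map Supermanifold.tangentFunctor

/-- A vector field `ψ` on `𝒢` is multiplicative if some vector field on the space of composable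
pairs is `p₁`-, `p₂`- and `m`-related to `ψ`. -/
def IsMultiplicative (𝒢 : Supergroupoid) (ψ : Supermanifold.VectorField 𝒢.mor) : Prop :=
  ∃ ψ₂ : Supermanifold.VectorField 𝒢.comp,
    Supermanifold.Related 𝒢.p₁ ψ₂ ψ ∧ Supermanifold.Related 𝒢.p₂ ψ₂ ψ ∧
      Supermanifold.Related 𝒢.m ψ₂ ψ

end Supergroupoid

end

/-!
The proof of both parts rests on the fact that derivations along morphisms are themselves morphisms,
from supermanifolds with additional odd coordinates, so that every statement about the tangent
groupoid is a statement about points of the given groupoid; no fibre products of supermanifolds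
have to be constructed.

For odd `j` let `S[η]` be the supermanifold `S` with one coordinate `η` of degree `-j` adjoined
(`Supermanifold.oddExtension`).  Since `η² = 0`, its functions are the sums `a + η b`, and a
morphism `S[η] ⟶ M` is a morphism `f : S ⟶ M` together with a derivation `X` of degree `j` along
`f`, through `a ↦ f^* a + η X a` (`homOfDerivation`, `derivationOfHom`).  For even `j` the
coordinate `η` would not be nilpotent; instead, a derivation `X` of degree `j` is replaced by the
derivation `η X` of odd degree along `S[η] ⟶ S ⟶ M`, with `η` of degree `-1` (`etaMul`), from
which `X` is recovered as a component (`etaComponent`).  The manifold `S[η]` has charts because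
adjoining `η` to a polynomial algebra in graded-commuting coordinates gives such an algebra with
one coordinate more (`IsSuperPoly.oddExt`).

The universal property of a pullback of supermanifolds, applied to `S[η]`, lifts compatible pairs
of derivations (`exists_derivation_lift`), so the tangent functor preserves pullbacks
(`isPullback_tangentFunctor_map`).  The same morphisms separate tangent points
(`TangentPoint.eq_of_natural`), which reduces associativity of the tangent groupoid to
associativity in the given one (`GroupoidData.IsGroupoid.map`).

A vector field is related to another one along a morphism if and only if the corresponding sections
are compatible with its tangent map (`related_iff_toSection`).  If `ψ` is multiplicative, the
section of `ψ₂` is therefore a map of composable pairs over `ψ`, and in any category a map of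
arrows that is covered by such a map is a morphism of groupoids: restricting to the pairs `(g, 1)`
and `(1, g)` gives the map on objects, units go to idempotents, hence to units, and inverses to
inverses (`GroupoidData.IsGroupoid.isMorphism_of_comp`).  Conversely, a morphism of groupoids
induces a map from composable pairs to the tangent bundle of the space of composable pairs; its
composites with the projections show that it is a section, that is, a vector field `ψ₂`.
-/

noncomputable section

/-! ### The parity automorphism of a graded algebra -/

theorem negOnePow_odd_mul {j : ℤ} (hj : Odd j) (k : ℤ) : (j * k).negOnePow = k.negOnePow := by
  obtain ⟨m, rfl⟩ := hj
  rw [show (2 * m + 1) * k = k + 2 * (m * k) by ring, Int.negOnePow_add, Int.negOnePow_two_mul,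
    mul_one]

section Parity

variable {A : Type} [Ring A] [Algebra ℝ A] {𝒜 : ℤ → Submodule ℝ A}

theorem DirectSum.IsInternal.induction_homogeneous (h : DirectSum.IsInternal 𝒜) {P : A → Prop}
    (hom : ∀ (i : ℤ) (a : A), a ∈ 𝒜 i → P a) (add : ∀ a b, P a → P b → P (a + b)) (a : A) : P a := by
  let := h.chooseDecomposition
  exact DirectSum.Decomposition.inductionOn 𝒜 (hom 0 0 (zero_mem _)) (fun m => hom _ m m.2)
    (fun a b => add a b) a

/-- Sums with one term in each degree are equal only if the terms are. -/
theorem DirectSum.IsInternal.eq_of_sum_eq (h : DirectSum.IsInternal 𝒜) (s : Finset ℤ)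
    (u v : ℤ → A) (i : ℤ) (hu : ∀ j, u j ∈ 𝒜 (j + i)) (hv : ∀ j, v j ∈ 𝒜 (j + i))
    (huv : ∑ j ∈ s, u j = ∑ j ∈ s, v j) (j : ℤ) (hj : j ∈ s) : u j = v j := by
  let := h.chooseDecomposition
  have key : ∀ w : ℤ → A, (∀ j, w j ∈ 𝒜 (j + i)) →
      (DirectSum.decompose 𝒜 (∑ j ∈ s, w j) (j + i) : A) = w j := by
    intro w hw
    rw [DirectSum.decompose_sum, DirectSum.sum_apply, AddSubmonoidClass.coe_finsetSum,
      Finset.sum_eq_single_of_mem j hj, DirectSum.decompose_of_mem_same _ (hw j)]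
    intro k _ hk
    exact DirectSum.decompose_of_mem_ne _ (hw k) (by omega)
  rw [← key u hu, huv, key v hv]

/-- The parity map as a linear map: multiplication by `(-1)^i` in degree `i`. -/
def parityLinear (h : DirectSum.IsInternal 𝒜) : A →ₗ[ℝ] A :=
  letI := h.chooseDecomposition
  (DirectSum.toModule ℝ ℤ A fun i => (i.negOnePow : ℤ) • (𝒜 i).subtype) ∘ₗ
    (DirectSum.decomposeLinearEquiv 𝒜).toLinearMap

theorem parityLinear_of_mem (h : DirectSum.IsInternal 𝒜) {i : ℤ} {a : A} (ha : a ∈ 𝒜 i) :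
    parityLinear h a = (i.negOnePow : ℤ) • a := by
  let := h.chooseDecomposition
  lift a to 𝒜 i using ha
  simp [parityLinear]

/-- The parity automorphism `a ↦ (-1)^{|a|} a` of a `ℤ`-graded algebra. -/
def parity [SetLike.GradedMonoid 𝒜] (h : DirectSum.IsInternal 𝒜) : A →ₐ[ℝ] A :=
  AlgHom.ofLinearMap (parityLinear h)
    (by rw [parityLinear_of_mem h SetLike.GradedOne.one_mem]; simp)
    (fun a b => by
      induction a using h.induction_homogeneous with
      | add a a' ha ha' => simp only [add_mul, map_add, ha, ha']
      | hom i a ha =>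
        induction b using h.induction_homogeneous with
        | add b b' hb hb' => simp only [mul_add, map_add, hb, hb']
        | hom j b hb =>
          rw [parityLinear_of_mem h ha, parityLinear_of_mem h hb,
            parityLinear_of_mem h (SetLike.GradedMul.mul_mem ha hb), Int.negOnePow_add,
            smul_mul_smul_comm, Units.val_mul])

theorem parity_of_mem [SetLike.GradedMonoid 𝒜] (h : DirectSum.IsInternal 𝒜) {i : ℤ} {a : A}
    (ha : a ∈ 𝒜 i) : parity h a = (i.negOnePow : ℤ) • a :=
  parityLinear_of_mem h ha

end Parity

/-! ### Adjoining one odd coordinate to an algebra -/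

/-- The algebra `A[η]` obtained by adjoining to `A` an element `η` with `η² = 0` and
`a η = η σ(a)`.  The pair `(a, b)` stands for `a + η b`. -/
def OddExt {R A : Type} [CommRing R] [Ring A] [Algebra R A] (_σ : A →ₐ[R] A) : Type := A × A

namespace OddExt

variable {R A : Type} [CommRing R] [Ring A] [Algebra R A] {σ : A →ₐ[R] A}

instance : AddCommGroup (OddExt σ) := inferInstanceAs (AddCommGroup (A × A))

instance : Module R (OddExt σ) := inferInstanceAs (Module R (A × A))

/-- The element `a + η b`. -/
def mk (σ : A →ₐ[R] A) (a b : A) : OddExt σ := (a, b)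

/-- The first component of `a + η b`. -/
def fst : OddExt σ →ₗ[R] A := LinearMap.fst R A A

/-- The second component of `a + η b`. -/
def snd : OddExt σ →ₗ[R] A := LinearMap.snd R A A

@[ext] theorem ext {x y : OddExt σ} (h₁ : x.fst = y.fst) (h₂ : x.snd = y.snd) : x = y :=
  Prod.ext h₁ h₂

@[simp] theorem fst_mk (a b : A) : (mk σ a b).fst = a := rfl

@[simp] theorem snd_mk (a b : A) : (mk σ a b).snd = b := rfl

instance : One (OddExt σ) := ⟨mk σ 1 0⟩

instance : Mul (OddExt σ) := ⟨fun x y => mk σ (x.fst * y.fst) (x.snd * y.fst + σ x.fst * y.snd)⟩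

@[simp] theorem fst_one : (1 : OddExt σ).fst = 1 := rfl

@[simp] theorem snd_one : (1 : OddExt σ).snd = 0 := rfl

@[simp] theorem fst_mul (x y : OddExt σ) : (x * y).fst = x.fst * y.fst := rfl

@[simp] theorem snd_mul (x y : OddExt σ) :
    (x * y).snd = x.snd * y.fst + σ x.fst * y.snd := rfl

instance : Ring (OddExt σ) :=
  { (inferInstance : AddCommGroup (OddExt σ)) with
    one := 1
    mul := (· * ·)
    one_mul := fun x => by ext <;> simp
    mul_one := fun x => by ext <;> simp
    zero_mul := fun x => by ext <;> simp
    mul_zero := fun x => by ext <;> simp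
    left_distrib := fun x y z => by ext <;> simp [mul_add]; abel
    right_distrib := fun x y z => by ext <;> simp [add_mul]; abel
    mul_assoc := fun x y z => by ext <;> simp [mul_assoc, add_mul, mul_add, add_assoc] }

instance : Algebra R (OddExt σ) :=
  Algebra.ofModule (fun r x y => by ext <;> simp) (fun r x y => by ext <;> simp)

theorem algebraMap_eq (r : R) : algebraMap R (OddExt σ) r = mk σ (algebraMap R A r) 0 := by
  rw [Algebra.algebraMap_eq_smul_one]
  ext <;> simp [Algebra.algebraMap_eq_smul_one]

/-- The inclusion of `A` in `A[η]`. -/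
def inl (σ : A →ₐ[R] A) : A →ₐ[R] OddExt σ where
  toFun a := mk σ a 0
  map_one' := rfl
  map_mul' a b := by ext <;> simp
  map_zero' := rfl
  map_add' a b := by ext <;> simp
  commutes' r := (algebraMap_eq r).symm

/-- The algebra map `A[η] → A` that sends `η` to zero. -/
def fstHom (σ : A →ₐ[R] A) : OddExt σ →ₐ[R] A where
  toFun x := x.fst
  map_one' := rfl
  map_mul' a b := rfl
  map_zero' := rfl
  map_add' a b := rfl
  commutes' r := by rw [algebraMap_eq]; rfl

@[simp] theorem fst_inl (a : A) : (inl σ a).fst = a := rfl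

@[simp] theorem snd_inl (a : A) : (inl σ a).snd = 0 := rfl

/-- The coordinate `η` of `A[η]`. -/
def eta (σ : A →ₐ[R] A) : OddExt σ := mk σ 0 1

@[simp] theorem fst_eta : (eta σ).fst = 0 := rfl

@[simp] theorem snd_eta : (eta σ).snd = 1 := rfl

theorem eq_inl_add (x : OddExt σ) : x = inl σ x.fst + eta σ * inl σ x.snd := by
  ext <;> simp

/-- An algebra map that commutes with the parities extends to the algebras with `η` adjoined. -/
def map {B : Type} [Ring B] [Algebra R B] {τ : B →ₐ[R] B} (f : A →ₐ[R] B)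
    (h : ∀ a, f (σ a) = τ (f a)) : OddExt σ →ₐ[R] OddExt τ where
  toFun x := mk τ (f x.fst) (f x.snd)
  map_one' := by ext <;> simp
  map_mul' a b := by ext <;> simp [h]
  map_zero' := by ext <;> simp
  map_add' a b := by ext <;> simp
  commutes' r := by simp [algebraMap_eq]

end OddExt

/-! ### Polynomial algebras in graded-commuting coordinates -/

/-- `A` is the algebra of polynomials over `R` in graded-commuting coordinates `ξ x` of degree
`deg x`: it is generated by the coordinates, they commute up to the sign, and it is universal with
these properties. -/
structure IsSuperPoly (R : Type) [CommRing R] {X : Type} (deg : X → ℤ) (A : Type) [Ring A]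
    [Algebra R A] (ξ : X → A) : Prop where
  comm : ∀ x y, ξ x * ξ y = ((deg x * deg y).negOnePow : ℤ) • (ξ y * ξ x)
  adjoin_eq_top : Algebra.adjoin R (Set.range ξ) = ⊤
  exists_lift : ∀ {B : Type} [Ring B] [Algebra R B] (c : X → B),
    (∀ x y, c x * c y = ((deg x * deg y).negOnePow : ℤ) • (c y * c x)) →
    ∃ F : A →ₐ[R] B, ∀ x, F (ξ x) = c x

namespace IsSuperPoly

variable {R X A : Type} [CommRing R] {deg : X → ℤ} [Ring A] [Algebra R A] {ξ : X → A}

theorem hom_ext (h : IsSuperPoly R deg A ξ) {B : Type} [Ring B] [Algebra R B] {F G : A →ₐ[R] B}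
    (hFG : ∀ x, F (ξ x) = G (ξ x)) : F = G :=
  AlgHom.ext_of_adjoin_eq_top h.adjoin_eq_top (by rintro _ ⟨x, rfl⟩; exact hFG x)

theorem induction (h : IsSuperPoly R deg A ξ) {P : A → Prop}
    (scalar : ∀ r, P (algebraMap R A r)) (coord : ∀ x, P (ξ x))
    (add : ∀ a b, P a → P b → P (a + b)) (mul : ∀ a b, P a → P b → P (a * b)) (a : A) : P a := by
  have ha : a ∈ Algebra.adjoin R (Set.range ξ) := by rw [h.adjoin_eq_top]; trivial
  induction ha using Algebra.adjoin_induction with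
  | mem x hx => obtain ⟨x, rfl⟩ := hx; exact coord x
  | algebraMap r => exact scalar r
  | add a b _ _ ha hb => exact add a b ha hb
  | mul a b _ _ ha hb => exact mul a b ha hb

theorem reindex {Y : Type} {degY : Y → ℤ} (h : IsSuperPoly R deg A ξ) (e : Y ≃ X)
    (he : ∀ y, degY y = deg (e y)) : IsSuperPoly R degY A (ξ ∘ e) where
  comm x y := by simp only [Function.comp_apply, he]; exact h.comm _ _
  adjoin_eq_top := by rw [e.surjective.range_comp]; exact h.adjoin_eq_top
  exists_lift c hc := by
    obtain ⟨F, hF⟩ := h.exists_lift (c ∘ e.symm) fun x y => by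
      have := hc (e.symm x) (e.symm y)
      rwa [he, he, e.apply_symm_apply, e.apply_symm_apply] at this
    exact ⟨F, fun y => by simp [hF]⟩

/-- The parity automorphism `ξ ↦ (-1)^{|ξ|} ξ`, constructed from universality and linear over the
degree zero coefficients. -/
theorem exists_parity (h : IsSuperPoly R deg A ξ) :
    ∃ σ : A →ₐ[R] A, ∀ x, σ (ξ x) = ((deg x).negOnePow : ℤ) • ξ x :=
  h.exists_lift _ fun x y => by
    simp only [smul_mul_smul_comm]
    rw [h.comm x y, smul_comm, mul_comm ((deg x).negOnePow : ℤ)]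

/-- The degrees of the coordinates after one coordinate of degree `d` has been adjoined. -/
def optionDegree (deg : X → ℤ) (d : ℤ) (x : Option X) : ℤ := x.elim d deg

/-- The coordinates of `A[η]`: `η`, and those of `A`. -/
def optionCoord (σ : A →ₐ[R] A) (ξ : X → A) (x : Option X) : OddExt σ :=
  x.elim (OddExt.eta σ) fun x => OddExt.inl σ (ξ x)

/-- Adjoining an odd element to a polynomial algebra in graded-commuting coordinates gives the
polynomial algebra with one coordinate more. -/
theorem oddExt [Algebra ℝ R] (h : IsSuperPoly R deg A ξ) {σ : A →ₐ[R] A}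
    (hσ : ∀ x, σ (ξ x) = ((deg x).negOnePow : ℤ) • ξ x) {d : ℤ} (hd : Odd d) :
    IsSuperPoly R (optionDegree deg d) (OddExt σ) (optionCoord σ ξ) where
  comm := by
    have h1 : ∀ x, OddExt.inl σ (ξ x) * OddExt.eta σ =
        ((deg x).negOnePow : ℤ) • (OddExt.eta σ * OddExt.inl σ (ξ x)) := by
      intro x
      ext
      · simp only [map_zsmul, OddExt.fst_mul, OddExt.fst_eta, zero_mul, mul_zero, smul_zero]
      · simp only [map_zsmul, OddExt.snd_mul, OddExt.snd_eta, OddExt.fst_eta, OddExt.fst_inl,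
          OddExt.snd_inl, mul_zero, one_mul, mul_one, zero_add, add_zero, hσ, map_zero]
    rintro (_ | x) (_ | y)
    · ext <;> simp [optionCoord]
    · simp only [optionCoord, optionDegree, Option.elim]
      rw [h1, negOnePow_odd_mul hd, smul_smul, ← Units.val_mul, ← Int.negOnePow_add,
        Int.negOnePow_even _ ⟨_, rfl⟩, Units.val_one, one_smul]
    · simp only [optionCoord, optionDegree, Option.elim]
      rw [h1, mul_comm _ d, negOnePow_odd_mul hd]
    · simp only [optionCoord, optionDegree, Option.elim]
      rw [← map_mul, ← map_mul, h.comm, map_zsmul]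
  adjoin_eq_top := by
    rw [eq_top_iff]
    rintro x -
    have hinl : ∀ a, OddExt.inl σ a ∈ Algebra.adjoin R (Set.range (optionCoord σ ξ)) := by
      intro a
      induction a using h.induction with
      | scalar r => rw [AlgHom.commutes]; exact Subalgebra.algebraMap_mem _ _
      | coord x => exact Algebra.subset_adjoin ⟨some x, rfl⟩
      | add a b ha hb => rw [map_add]; exact add_mem ha hb
      | mul a b ha hb => rw [map_mul]; exact mul_mem ha hb
    rw [OddExt.eq_inl_add x]
    exact add_mem (hinl _) (mul_mem (Algebra.subset_adjoin ⟨none, rfl⟩) (hinl _))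
  exists_lift {B} _ _ c hc := by
    obtain ⟨F, hF⟩ := h.exists_lift (fun x => c (some x)) fun x y => hc (some x) (some y)
    -- The sign rule only gives `2 η² = 0`; `2` is invertible because `R` is a real algebra.
    have hsq : c none * c none = 0 := by
      have h1 : c none * c none = -(c none * c none) := by
        have := hc none none
        rwa [show optionDegree deg d none = d from rfl, Int.negOnePow_odd _ (hd.mul hd),
          Units.val_neg, Units.val_one, neg_one_smul] at this
      let := Algebra.compHom B (algebraMap ℝ R)
      have h2 : (2 : ℝ) • (c none * c none) = 0 := by
        rw [two_smul]; nth_rewrite 1 [h1]; exact neg_add_cancel _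
      exact (smul_eq_zero_iff_right two_ne_zero).mp h2
    have hcomm : ∀ a, F a * c none = c none * F (σ a) := by
      intro a
      induction a using h.induction with
      | scalar r => rw [AlgHom.commutes, AlgHom.commutes, AlgHom.commutes, Algebra.commutes]
      | coord x =>
        rw [hσ, map_zsmul, hF, hc (some x) none, mul_smul_comm]
        change ((deg x * d).negOnePow : ℤ) • _ = _
        rw [mul_comm _ d, negOnePow_odd_mul hd]
      | add a b ha hb => simp only [map_add, add_mul, mul_add, ha, hb]
      | mul a b ha hb => rw [map_mul, map_mul, map_mul, mul_assoc, hb, ← mul_assoc, ha, mul_assoc]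
    refine ⟨AlgHom.ofLinearMap (F.toLinearMap ∘ₗ OddExt.fst +
      LinearMap.mulLeft R (c none) ∘ₗ F.toLinearMap ∘ₗ OddExt.snd) (by simp) ?_, ?_⟩
    · intro x y
      simp only [LinearMap.add_apply, LinearMap.comp_apply, AlgHom.toLinearMap_apply,
        LinearMap.mulLeft_apply, OddExt.fst_mul, OddExt.snd_mul, map_mul, map_add]
      have h3 : c none * F x.snd * (c none * F y.snd) = 0 := by
        rw [mul_assoc, ← mul_assoc (F x.snd), hcomm, mul_assoc, ← mul_assoc, hsq, zero_mul]
      rw [add_mul, mul_add, mul_add, h3, ← mul_assoc (F x.fst) (c none), hcomm, add_zero]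
      simp only [mul_assoc]
      abel
    · rintro (_ | x)
      · simp [optionCoord]
      · simp [optionCoord, hF]

/-- Polynomial algebras in the same coordinates are isomorphic. -/
theorem exists_bijective (h : IsSuperPoly R deg A ξ) {B : Type} [Ring B] [Algebra R B] {ζ : X → B}
    (h' : IsSuperPoly R deg B ζ) :
    ∃ F : A →ₐ[R] B, Function.Bijective F ∧ ∀ x, F (ξ x) = ζ x := by
  obtain ⟨F, hF⟩ := h.exists_lift ζ h'.comm
  obtain ⟨G, hG⟩ := h'.exists_lift ξ h.comm
  have h1 : G.comp F = AlgHom.id R A := h.hom_ext fun x => by simp [hF, hG]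
  have h2 : F.comp G = AlgHom.id R B := h'.hom_ext fun x => by simp [hF, hG]
  exact ⟨F, Function.bijective_iff_has_inverse.2
    ⟨G, fun a => DFunLike.congr_fun h1 a, fun b => DFunLike.congr_fun h2 b⟩, hF⟩

end IsSuperPoly

theorem SuperFun.isSuperPoly (p : ℤ → ℕ) (W : Opens (Body p)) :
    IsSuperPoly (BodyFun p W) SuperCoord.degree (SuperFun p W) (SuperFun.coord W) where
  comm a b := by
    have := RingQuot.mkAlgHom_rel (BodyFun p W) (SuperRel.comm (p := p) (W := W) a b)
    rw [map_mul, map_zsmul, map_mul] at this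
    exact this
  adjoin_eq_top := by
    have := FreeAlgebra.adjoin_range_ι (BodyFun p W) (SuperCoord p)
    have h2 := congrArg
      (Subalgebra.map (RingQuot.mkAlgHom (BodyFun p W) (SuperRel p W))) this
    rw [AlgHom.map_adjoin, ← Set.range_comp, Algebra.map_top,
      (AlgHom.range_eq_top _).2 (RingQuot.mkAlgHom_surjective _ _)] at h2
    exact h2
  exists_lift {B} _ _ c hc := by
    refine ⟨RingQuot.liftAlgHom (BodyFun p W) ⟨FreeAlgebra.lift (BodyFun p W) c, ?_⟩, ?_⟩
    · rintro _ _ ⟨a, b⟩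
      simp only [map_mul, map_zsmul, FreeAlgebra.lift_ι_apply]
      exact hc a b
    · intro x
      rw [SuperFun.coord, RingQuot.liftAlgHom_mkAlgHom_apply, FreeAlgebra.lift_ι_apply]

theorem SuperFun.induction {p : ℤ → ℕ} {W : Opens (Body p)} {P : SuperFun p W → Prop}
    (ofBody : ∀ f, P (SuperFun.ofBody f)) (coord : ∀ x, P (SuperFun.coord W x))
    (add : ∀ a b, P a → P b → P (a + b)) (mul : ∀ a b, P a → P b → P (a * b))
    (a : SuperFun p W) : P a :=
  (SuperFun.isSuperPoly p W).induction ofBody coord add mul a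

/-! ### Adjoining one odd coordinate to a graded space -/

/-- Algebra maps that preserve degrees commute with the parity automorphisms. -/
theorem map_parity {A B : Type} [Ring A] [Algebra ℝ A] [Ring B] [Algebra ℝ B]
    {𝒜 : ℤ → Submodule ℝ A} {ℬ : ℤ → Submodule ℝ B} [SetLike.GradedMonoid 𝒜]
    [SetLike.GradedMonoid ℬ] (hA : DirectSum.IsInternal 𝒜) (hB : DirectSum.IsInternal ℬ)
    (f : A →ₐ[ℝ] B) (hf : ∀ i a, a ∈ 𝒜 i → f a ∈ ℬ i) (a : A) :
    f (parity hA a) = parity hB (f a) := by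
  induction a using hA.induction_homogeneous with
  | hom i a ha => rw [parity_of_mem hA ha, parity_of_mem hB (hf i a ha), map_zsmul]
  | add a b ha hb => simp only [map_add, ha, hb]

namespace OddExt

variable {A : Type} [Ring A] [Algebra ℝ A] {𝒜 : ℤ → Submodule ℝ A} {σ : A →ₐ[ℝ] A}

/-- The grading of `A[η]` for `η` of degree `-j`: in `a + η b` of degree `k`, the component `b`
has degree `j + k`. -/
def deg (σ : A →ₐ[ℝ] A) (𝒜 : ℤ → Submodule ℝ A) (j k : ℤ) : Submodule ℝ (OddExt σ) :=
  (𝒜 k).comap fst ⊓ (𝒜 (j + k)).comap snd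

theorem mem_deg {j k : ℤ} {x : OddExt σ} :
    x ∈ deg σ 𝒜 j k ↔ x.fst ∈ 𝒜 k ∧ x.snd ∈ 𝒜 (j + k) := Iff.rfl

theorem isInternal_deg (h : DirectSum.IsInternal 𝒜) (j : ℤ) :
    DirectSum.IsInternal (deg σ 𝒜 j) := by
  -- The two components of a sum of homogeneous elements are sums of homogeneous elements of `A`,
  -- the second with the degrees shifted by `j`.
  have hfst : ∀ z : ⨁ k, deg σ 𝒜 j k, (DirectSum.coeAddMonoidHom (deg σ 𝒜 j) z).fst =
      DirectSum.coeAddMonoidHom 𝒜 (DirectSum.toModule ℝ ℤ (⨁ k, 𝒜 k)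
        (fun k => DirectSum.lof ℝ ℤ (fun k => 𝒜 k) k ∘ₗ
          (fst ∘ₗ (deg σ 𝒜 j k).subtype).codRestrict (𝒜 k) fun x => x.2.1) z) := by
    intro z
    induction z using DirectSum.induction_on with
    | zero => simp
    | of k x =>
      rw [← DirectSum.lof_eq_of ℝ, DirectSum.toModule_lof]
      simp [DirectSum.lof_eq_of]
      rfl
    | add z w hz hw => simp only [map_add, hz, hw]
  have hsnd : ∀ z : ⨁ k, deg σ 𝒜 j k, (DirectSum.coeAddMonoidHom (deg σ 𝒜 j) z).snd =
      DirectSum.coeAddMonoidHom 𝒜 (DirectSum.toModule ℝ ℤ (⨁ k, 𝒜 k)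
        (fun k => DirectSum.lof ℝ ℤ (fun k => 𝒜 k) (j + k) ∘ₗ
          (snd ∘ₗ (deg σ 𝒜 j k).subtype).codRestrict (𝒜 (j + k)) fun x => x.2.2) z) := by
    intro z
    induction z using DirectSum.induction_on with
    | zero => simp
    | of k x =>
      rw [← DirectSum.lof_eq_of ℝ, DirectSum.toModule_lof]
      simp [DirectSum.lof_eq_of]
      rfl
    | add z w hz hw => simp only [map_add, hz, hw]
  have hcoe : ∀ (f : ℤ → ℤ) (hf : Function.Injective f) (g : ∀ k, deg σ 𝒜 j k →ₗ[ℝ] 𝒜 (f k))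
      (z : ⨁ k, deg σ 𝒜 j k) (k : ℤ), DirectSum.toModule ℝ ℤ (⨁ k, 𝒜 k)
        (fun k => DirectSum.lof ℝ ℤ (fun k => 𝒜 k) (f k) ∘ₗ g k) z (f k) = g k (z k) := by
    intro f hf g z k
    induction z using DirectSum.induction_on with
    | zero => simp
    | of i x =>
      rw [← DirectSum.lof_eq_of ℝ, DirectSum.toModule_lof]
      by_cases hik : i = k
      · subst hik
        simp [DirectSum.lof_eq_of]
      · rw [LinearMap.comp_apply, DirectSum.lof_eq_of, DirectSum.lof_eq_of,
          DirectSum.of_eq_of_ne _ _ _ (fun h => hik (hf h).symm),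
          DirectSum.of_eq_of_ne _ _ _ (fun h => hik h.symm), map_zero]
    | add z w hz hw => rw [map_add, DirectSum.add_apply, DirectSum.add_apply, map_add, hz, hw]
  refine ⟨(injective_iff_map_eq_zero _).2 fun z hz => ?_, fun x => ?_⟩
  · have h1 := hfst z
    have h2 := hsnd z
    rw [hz, map_zero] at h1 h2
    have h1' := (injective_iff_map_eq_zero _).1 h.injective _ h1.symm
    have h2' := (injective_iff_map_eq_zero _).1 h.injective _ h2.symm
    refine DFinsupp.ext fun k => Subtype.ext (OddExt.ext ?_ ?_)
    · have := hcoe _ Function.injective_id (fun k =>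
        (fst ∘ₗ (deg σ 𝒜 j k).subtype).codRestrict (𝒜 k) fun x => x.2.1) z k
      exact (congrArg Subtype.val (this.symm.trans (DFunLike.congr_fun h1' k)))
    · have := hcoe _ (add_right_injective j) (fun k =>
        (snd ∘ₗ (deg σ 𝒜 j k).subtype).codRestrict (𝒜 (j + k)) fun x => x.2.2) z k
      exact (congrArg Subtype.val (this.symm.trans (DFunLike.congr_fun h2' (j + k))))
  · change x ∈ AddMonoidHom.mrange (DirectSum.coeAddMonoidHom (deg σ 𝒜 j))
    have hmem : ∀ k (y : OddExt σ), y ∈ deg σ 𝒜 j k →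
        y ∈ AddMonoidHom.mrange (DirectSum.coeAddMonoidHom (deg σ 𝒜 j)) := fun k y hy =>
      ⟨DirectSum.of _ k ⟨y, hy⟩, DirectSum.coeAddMonoidHom_of _ _ _⟩
    have hx : x = mk σ x.fst 0 + mk σ 0 x.snd := by ext <;> simp
    rw [hx]
    refine add_mem ?_ ?_
    · generalize x.fst = a
      induction a using h.induction_homogeneous with
      | hom k a ha => exact hmem k _ (mem_deg.2 ⟨ha, zero_mem _⟩)
      | add a b ha hb =>
        convert add_mem ha hb using 1
        ext <;> simp
    · generalize x.snd = a
      induction a using h.induction_homogeneous with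
      | hom k a ha =>
        refine hmem (k - j) _ (mem_deg.2 ⟨zero_mem _, ?_⟩)
        rw [add_sub_cancel]
        exact ha
      | add a b ha hb =>
        convert add_mem ha hb using 1
        ext <;> simp

end OddExt

namespace GradedSpace

/-- The parity automorphism of the sections over `U`. -/
def parity (X : GradedSpace) (U : Opens X.carrier) : X.sec U →ₐ[ℝ] X.sec U :=
  _root_.parity (X.isInternal U)

theorem parity_of_mem (X : GradedSpace) (U : Opens X.carrier) {i : ℤ} {a : X.sec U}
    (ha : a ∈ X.deg U i) : X.parity U a = (i.negOnePow : ℤ) • a :=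
  _root_.parity_of_mem _ ha

theorem res_parity (X : GradedSpace) {U V : Opens X.carrier} (h : U ≤ V) (a : X.sec V) :
    X.res h (X.parity V a) = X.parity U (X.res h a) :=
  map_parity _ _ _ (X.res_deg h) a

/-- The graded space `X[η]`, with one coordinate `η` of odd degree `-j` adjoined: the sections are
the sums `a + η b`.  It is reducible, like the supermanifold below, so that the instances on the
sections of `X` are found on the components. -/
abbrev oddExtension (X : GradedSpace) (j : ℤ) (hj : Odd j) : GradedSpace where
  carrier := X.carrier
  sec U := OddExt (X.parity U)
  deg U := OddExt.deg (X.parity U) (X.deg U) j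
  gradedMonoid U :=
    { one_mem := OddExt.mem_deg.2 ⟨SetLike.GradedOne.one_mem, zero_mem _⟩
      mul_mem := by
        rintro k l x y ⟨hx0, hx1⟩ ⟨hy0, hy1⟩
        refine OddExt.mem_deg.2 ⟨SetLike.GradedMul.mul_mem hx0 hy0, ?_⟩
        rw [OddExt.snd_mul]
        refine add_mem ?_ ?_
        · rw [← add_assoc]
          exact SetLike.GradedMul.mul_mem hx1 hy0
        · rw [X.parity_of_mem U hx0, add_left_comm, smul_mul_assoc]
          exact zsmul_mem (SetLike.GradedMul.mul_mem
            (show OddExt.fst x ∈ X.deg U k from hx0)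
            (show OddExt.snd y ∈ X.deg U (j + l) from hy1)) _ }
  isInternal U := OddExt.isInternal_deg (X.isInternal U) j
  graded_comm := by
    rintro U k l x y ⟨hx0, hx1⟩ ⟨hy0, hy1⟩
    ext
    · rw [map_zsmul]
      exact X.graded_comm U k l _ _ hx0 hy0
    · rw [map_zsmul, OddExt.snd_mul, OddExt.snd_mul, X.parity_of_mem U hx0,
        X.parity_of_mem U hy0, X.graded_comm U _ _ _ _ hx1 hy0, smul_mul_assoc, smul_mul_assoc,
        X.graded_comm U _ _ _ _ hx0 hy1, add_mul, mul_add, Int.negOnePow_add, Int.negOnePow_add,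
        mul_comm k j, negOnePow_odd_mul hj, negOnePow_odd_mul hj, smul_smul, smul_add, smul_smul,
        ← Units.val_mul, ← Units.val_mul, ← mul_assoc, Int.units_mul_self, one_mul, add_comm,
        mul_comm (l.negOnePow)]
  res h := OddExt.map (X.res h) (X.res_parity h)
  res_deg h i a ha := ⟨X.res_deg h _ _ ha.1, X.res_deg h _ _ ha.2⟩
  res_refl U a := OddExt.ext (X.res_refl U _) (X.res_refl U _)
  res_res h h' a := OddExt.ext (X.res_res h h' _) (X.res_res h h' _)
  glue U k a ha hc := by
    obtain ⟨b, ⟨hb, hb'⟩, hbu⟩ := X.glue U k (fun i => (a i).fst) (fun i => (ha i).1)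
      fun i j => congrArg OddExt.fst (hc i j)
    obtain ⟨c, ⟨hc, hc'⟩, hcu⟩ := X.glue U (j + k) (fun i => (a i).snd) (fun i => (ha i).2)
      fun i j => congrArg OddExt.snd (hc i j)
    refine ⟨OddExt.mk _ b c, ⟨⟨hb, hc⟩, fun i => OddExt.ext (hb' i) (hc' i)⟩, ?_⟩
    rintro y ⟨hy, hy'⟩
    exact OddExt.ext (hbu _ ⟨hy.1, fun i => congrArg OddExt.fst (hy' i)⟩)
      (hcu _ ⟨hy.2, fun i => congrArg OddExt.snd (hy' i)⟩)
  eval U := (X.eval U).comp (OddExt.fstHom _)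
  eval_res h a x := X.eval_res h _ x

end GradedSpace

/-! ### Charts of the extended space -/

/-- The dimension `p` with one coordinate of index `j ≠ 0` added.  The value at `0` is matched
literally, so that the two bodies agree by definition. -/
def extDim (p : ℤ → ℕ) (j : ℤ) : ℤ → ℕ
  | 0 => p 0
  | i => p i + if i = j then 1 else 0

theorem extDim_of_ne {p : ℤ → ℕ} {j i : ℤ} (hi : i ≠ 0) :
    extDim p j i = p i + if i = j then 1 else 0 := by
  unfold extDim
  split
  · exact absurd rfl hi
  · rfl

/-- The coordinates of nonzero degree of the extended superspace: the additional one and the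
old ones. -/
def extCoord (p : ℤ → ℕ) {j : ℤ} (hj : j ≠ 0) :
    SuperCoord (extDim p j) ≃ Option (SuperCoord p) where
  toFun a := if h : a.2.1 < p a.1.1 then some ⟨a.1, ⟨a.2.1, h⟩⟩ else none
  invFun b := b.elim ⟨⟨j, hj⟩, ⟨p j, by rw [extDim_of_ne hj, if_pos rfl]; omega⟩⟩
    fun a => ⟨a.1, ⟨a.2.1, by rw [extDim_of_ne a.1.2]; omega⟩⟩
  left_inv := by
    rintro ⟨⟨i, hi⟩, ⟨k, hk⟩⟩
    by_cases h : k < p i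
    · simp [h]
    · have hk' := hk
      simp only [extDim_of_ne hi] at hk'
      have hij : i = j := by
        by_contra hij
        rw [if_neg hij] at hk'
        omega
      subst hij
      have : k = p i := by rw [if_pos rfl] at hk'; omega
      subst this
      simp
  right_inv := by
    rintro (_ | ⟨i, ⟨k, hk⟩⟩)
    · simp
    · simp [hk]

theorem extCoord_degree (p : ℤ → ℕ) {j : ℤ} (hj : j ≠ 0) (a : SuperCoord (extDim p j)) :
    a.degree = IsSuperPoly.optionDegree SuperCoord.degree (-j) (extCoord p hj a) := by
  obtain ⟨b, rfl⟩ := (extCoord p hj).symm.surjective a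
  rw [Equiv.apply_symm_apply]
  rcases b with _ | b <;> rfl

theorem ne_zero_of_odd {j : ℤ} (hj : Odd j) : j ≠ 0 := by
  rintro rfl
  exact absurd hj (by decide)

/-- The functions on the extended superdomain are the functions on the superdomain with one odd
element adjoined. -/
theorem SuperFun.exists_splitHom (p : ℤ → ℕ) {j : ℤ} (hj : Odd j) (W : Opens (Body p)) :
    ∃ (σ : SuperFun p W →ₐ[BodyFun p W] SuperFun p W)
      (F : SuperFun (extDim p j) W →+* OddExt σ), Function.Bijective F ∧
      (∀ a, σ (SuperFun.coord W a) = (a.degree.negOnePow : ℤ) • SuperFun.coord W a) ∧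
      (∀ f : BodyFun p W, F (SuperFun.ofBody (p := extDim p j) f) =
        OddExt.inl σ (SuperFun.ofBody f)) ∧
      ∀ a, F (SuperFun.coord (p := extDim p j) W a) =
        IsSuperPoly.optionCoord σ (SuperFun.coord W) (extCoord p (ne_zero_of_odd hj) a) := by
  obtain ⟨σ, hσ⟩ := (SuperFun.isSuperPoly p W).exists_parity
  have h1 := (((SuperFun.isSuperPoly p W).oddExt hσ hj.neg).reindex (extCoord p (ne_zero_of_odd hj))
    (extCoord_degree p (ne_zero_of_odd hj)))
  let : Algebra (BodyFun p W) (SuperFun (extDim p j) W) :=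
    inferInstanceAs (Algebra (BodyFun (extDim p j) W) (SuperFun (extDim p j) W))
  have h2 : IsSuperPoly (BodyFun p W) SuperCoord.degree (SuperFun (extDim p j) W)
    (SuperFun.coord (p := extDim p j) W) := SuperFun.isSuperPoly (extDim p j) W
  obtain ⟨F, hF, hF'⟩ := IsSuperPoly.exists_bijective h2 h1
  exact ⟨σ, F, hF, hσ, fun f => (F.commutes f).trans (OddExt.algebraMap_eq f), hF'⟩

/-- The parity automorphism of `C^∞(W)[ξ]`.  It is chosen together with `SuperFun.splitHom`, hence
the parameter `j`. -/
def SuperFun.parity (p : ℤ → ℕ) {j : ℤ} (hj : Odd j) (W : Opens (Body p)) :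
    SuperFun p W →ₐ[BodyFun p W] SuperFun p W :=
  (SuperFun.exists_splitHom p hj W).choose

theorem SuperFun.parity_coord (p : ℤ → ℕ) {j : ℤ} (hj : Odd j) (W : Opens (Body p))
    (a : SuperCoord p) : SuperFun.parity p hj W (SuperFun.coord W a) =
      (a.degree.negOnePow : ℤ) • SuperFun.coord W a :=
  (SuperFun.exists_splitHom p hj W).choose_spec.choose_spec.2.1 a

/-- The identification of the functions on the extended superdomain with sums `a + η b`. -/
def SuperFun.splitHom (p : ℤ → ℕ) {j : ℤ} (hj : Odd j) (W : Opens (Body p)) :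
    SuperFun (extDim p j) W →+* OddExt (SuperFun.parity p hj W) :=
  (SuperFun.exists_splitHom p hj W).choose_spec.choose

theorem SuperFun.splitHom_bijective (p : ℤ → ℕ) {j : ℤ} (hj : Odd j) (W : Opens (Body p)) :
    Function.Bijective (SuperFun.splitHom p hj W) :=
  (SuperFun.exists_splitHom p hj W).choose_spec.choose_spec.1

theorem SuperFun.splitHom_ofBody (p : ℤ → ℕ) {j : ℤ} (hj : Odd j) (W : Opens (Body p))
    (f : BodyFun p W) : SuperFun.splitHom p hj W (SuperFun.ofBody (p := extDim p j) f) =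
      OddExt.inl _ (SuperFun.ofBody f) :=
  (SuperFun.exists_splitHom p hj W).choose_spec.choose_spec.2.2.1 f

theorem SuperFun.splitHom_coord (p : ℤ → ℕ) {j : ℤ} (hj : Odd j) (W : Opens (Body p))
    (a : SuperCoord (extDim p j)) :
    SuperFun.splitHom p hj W (SuperFun.coord (p := extDim p j) W a) =
      IsSuperPoly.optionCoord _ (SuperFun.coord W) (extCoord p (ne_zero_of_odd hj) a) :=
  (SuperFun.exists_splitHom p hj W).choose_spec.choose_spec.2.2.2 a

namespace SuperChart

variable {X : GradedSpace} {p : ℤ → ℕ}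

theorem toSec_parity (φ : SuperChart X p) {j : ℤ} (hj : Odd j) (W : Opens (Body p))
    (hW : (W : Set (Body p)) ⊆ φ.e.target) (a : SuperFun p W) :
    φ.toSec W hW (SuperFun.parity p hj W a) = X.parity _ (φ.toSec W hW a) := by
  induction a using SuperFun.induction with
  | ofBody f =>
    rw [X.parity_of_mem _ (φ.deg_ofBody W hW f), Int.negOnePow_zero, Units.val_one, one_smul]
    exact congrArg _ ((SuperFun.parity p hj W).commutes f)
  | coord a =>
    rw [X.parity_of_mem _ (φ.deg_coord W hW a), SuperFun.parity_coord, map_zsmul]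
  | add a b ha hb => simp only [map_add, ha, hb]
  | mul a b ha hb => simp only [map_mul, ha, hb]

theorem res_toSec_mem_range (φ : SuperChart X p) {W W' : Opens (Body p)} (h : W' ≤ W)
    (hW : (W : Set (Body p)) ⊆ φ.e.target) (a : SuperFun p W) :
    X.res (chartPull_mono φ.e h) (φ.toSec W hW a) ∈
      Set.range (φ.toSec W' (subset_trans h hW)) := by
  change _ ∈ (φ.toSec W' (subset_trans h hW)).range
  induction a using SuperFun.induction with
  | ofBody f => exact ⟨_, (φ.res_ofBody h hW f).symm⟩
  | coord a => exact ⟨_, (φ.res_coord h hW a).symm⟩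
  | add a b ha hb => rw [map_add, map_add]; exact add_mem ha hb
  | mul a b ha hb => rw [map_mul, map_mul]; exact mul_mem ha hb

/-- The map from functions on the extended superdomain to sections of the extended space. -/
def extToSec (φ : SuperChart X p) {j : ℤ} (hj : Odd j) (W : Opens (Body p))
    (hW : (W : Set (Body p)) ⊆ φ.e.target) :
    SuperFun (extDim p j) W →ₐ[ℝ] OddExt (X.parity (chartPull φ.e W)) where
  toFun a := OddExt.mk _ (φ.toSec W hW (SuperFun.splitHom p hj W a).fst)
    (φ.toSec W hW (SuperFun.splitHom p hj W a).snd)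
  map_one' := by rw [map_one]; ext <;> simp
  map_mul' a b := by rw [map_mul]; ext <;> simp [φ.toSec_parity hj]
  map_zero' := by rw [map_zero]; ext <;> simp
  map_add' a b := by rw [map_add]; ext <;> simp
  commutes' r := by
    have h : SuperFun.splitHom p hj W (algebraMap ℝ (SuperFun (extDim p j) W) r) =
        OddExt.inl _ (algebraMap ℝ (SuperFun p W) r) :=
      SuperFun.splitHom_ofBody p hj W (algebraMap ℝ (BodyFun p W) r)
    rw [h, OddExt.algebraMap_eq]
    simp

theorem extToSec_ofBody (φ : SuperChart X p) {j : ℤ} (hj : Odd j) (W : Opens (Body p))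
    (hW : (W : Set (Body p)) ⊆ φ.e.target) (f : BodyFun p W) :
    φ.extToSec hj W hW (SuperFun.ofBody (p := extDim p j) f) =
      OddExt.inl _ (φ.toSec W hW (SuperFun.ofBody f)) := by
  refine OddExt.ext ?_ ?_
  · change φ.toSec W hW (SuperFun.splitHom p hj W _).fst = _
    rw [SuperFun.splitHom_ofBody]; rfl
  · change φ.toSec W hW (SuperFun.splitHom p hj W _).snd = _
    rw [SuperFun.splitHom_ofBody]; exact map_zero _

theorem extToSec_coord (φ : SuperChart X p) {j : ℤ} (hj : Odd j) (W : Opens (Body p))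
    (hW : (W : Set (Body p)) ⊆ φ.e.target) (a : SuperCoord (extDim p j)) :
    φ.extToSec hj W hW (SuperFun.coord (p := extDim p j) W a) =
      IsSuperPoly.optionCoord _ (fun b => φ.toSec W hW (SuperFun.coord W b))
        (extCoord p (ne_zero_of_odd hj) a) := by
  refine OddExt.ext ?_ ?_
  · change φ.toSec W hW (SuperFun.splitHom p hj W _).fst = _
    rw [SuperFun.splitHom_coord]
    rcases extCoord p (ne_zero_of_odd hj) a with _ | b
    · exact map_zero _
    · rfl
  · change φ.toSec W hW (SuperFun.splitHom p hj W _).snd = _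
    rw [SuperFun.splitHom_coord]
    rcases extCoord p (ne_zero_of_odd hj) a with _ | b
    · exact map_one _
    · exact map_zero _

theorem map_res_extToSec_ofBody (φ : SuperChart X p) {j : ℤ} (hj : Odd j) {W W' : Opens (Body p)}
    (h : W' ≤ W) (hW : (W : Set (Body p)) ⊆ φ.e.target) (f : BodyFun p W) :
    OddExt.map (X.res (chartPull_mono φ.e h)) (X.res_parity (chartPull_mono φ.e h))
      (φ.extToSec hj W hW (SuperFun.ofBody (p := extDim p j) f)) =
      φ.extToSec hj W' (subset_trans h hW)
        (SuperFun.ofBody (p := extDim p j) (BodyFun.res (p := p) h f)) := by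
  rw [φ.extToSec_ofBody hj, φ.extToSec_ofBody hj]
  exact OddExt.ext (φ.res_ofBody h hW f) (map_zero (X.res (chartPull_mono φ.e h)))

theorem map_res_extToSec_coord (φ : SuperChart X p) {j : ℤ} (hj : Odd j) {W W' : Opens (Body p)}
    (h : W' ≤ W) (hW : (W : Set (Body p)) ⊆ φ.e.target) (a : SuperCoord (extDim p j)) :
    OddExt.map (X.res (chartPull_mono φ.e h)) (X.res_parity (chartPull_mono φ.e h))
      (φ.extToSec hj W hW (SuperFun.coord (p := extDim p j) W a)) =
      φ.extToSec hj W' (subset_trans h hW) (SuperFun.coord (p := extDim p j) W' a) := by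
  rw [φ.extToSec_coord hj, φ.extToSec_coord hj]
  rcases extCoord p (ne_zero_of_odd hj) a with _ | b
  · exact OddExt.ext (map_zero (X.res (chartPull_mono φ.e h)))
      (map_one (X.res (chartPull_mono φ.e h)))
  · exact OddExt.ext (φ.res_coord h hW b) (map_zero (X.res (chartPull_mono φ.e h)))

theorem extToSec_ofBody_mem_deg (φ : SuperChart X p) {j : ℤ} (hj : Odd j) (W : Opens (Body p))
    (hW : (W : Set (Body p)) ⊆ φ.e.target) (f : BodyFun p W) :
    φ.extToSec hj W hW (SuperFun.ofBody (p := extDim p j) f) ∈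
      OddExt.deg _ (X.deg (chartPull φ.e W)) j 0 := by
  rw [φ.extToSec_ofBody hj W hW f]
  exact OddExt.mem_deg.2 ⟨φ.deg_ofBody W hW f, zero_mem _⟩

theorem extToSec_coord_mem_deg (φ : SuperChart X p) {j : ℤ} (hj : Odd j) (W : Opens (Body p))
    (hW : (W : Set (Body p)) ⊆ φ.e.target) (a : SuperCoord (extDim p j)) :
    φ.extToSec hj W hW (SuperFun.coord (p := extDim p j) W a) ∈
      OddExt.deg _ (X.deg (chartPull φ.e W)) j a.degree := by
  rw [φ.extToSec_coord hj W hW a, extCoord_degree p (ne_zero_of_odd hj) a]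
  rcases extCoord p (ne_zero_of_odd hj) a with _ | b
  · refine OddExt.mem_deg.2 ⟨zero_mem _, ?_⟩
    change (1 : X.sec (chartPull φ.e W)) ∈ X.deg _ (j + -j)
    rw [add_neg_cancel]
    exact SetLike.GradedOne.one_mem
  · exact OddExt.mem_deg.2 ⟨φ.deg_coord W hW b, zero_mem _⟩

theorem eval_fst_extToSec_ofBody (φ : SuperChart X p) {j : ℤ} (hj : Odd j) (W : Opens (Body p))
    (hW : (W : Set (Body p)) ⊆ φ.e.target) (f : BodyFun p W) (x : chartPull φ.e W) :
    X.eval (chartPull φ.e W)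
      (φ.extToSec hj W hW (SuperFun.ofBody (p := extDim p j) f)).fst x = f ⟨φ.e x.1, x.2.2⟩ := by
  rw [φ.extToSec_ofBody hj W hW f]
  exact φ.eval_ofBody W hW f x

theorem eval_fst_extToSec_coord (φ : SuperChart X p) {j : ℤ} (hj : Odd j) (W : Opens (Body p))
    (hW : (W : Set (Body p)) ⊆ φ.e.target) (a : SuperCoord (extDim p j))
    (x : chartPull φ.e W) :
    X.eval (chartPull φ.e W)
      (φ.extToSec hj W hW (SuperFun.coord (p := extDim p j) W a)).fst x = 0 := by
  rw [φ.extToSec_coord hj W hW a]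
  rcases extCoord p (ne_zero_of_odd hj) a with _ | b
  · exact congrFun (map_zero (X.eval (chartPull φ.e W))) x
  · exact φ.eval_coord W hW b x

theorem extToSec_injective (φ : SuperChart X p) {j : ℤ} (hj : Odd j) (W : Opens (Body p))
    (hW : (W : Set (Body p)) ⊆ φ.e.target) : Function.Injective (φ.extToSec hj W hW) := by
  intro a b hab
  refine (SuperFun.splitHom_bijective p hj W).1 (OddExt.ext ?_ ?_)
  · exact φ.injective W hW (congrArg OddExt.fst hab)
  · exact φ.injective W hW (congrArg OddExt.snd hab)

theorem extToSec_locally_surjective (φ : SuperChart X p) {j : ℤ} (hj : Odd j)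
    (W : Opens (Body p)) (hW : (W : Set (Body p)) ⊆ φ.e.target)
    (b : OddExt (X.parity (chartPull φ.e W))) (x : Body p) (hx : x ∈ W) :
    ∃ (W' : Opens (Body p)) (h : W' ≤ W), x ∈ W' ∧
      OddExt.map (X.res (chartPull_mono φ.e h)) (X.res_parity (chartPull_mono φ.e h)) b ∈
        Set.range (φ.extToSec hj W' (subset_trans h hW)) := by
  obtain ⟨W₁, h₁, hx₁, a₁, ha₁⟩ := φ.locally_surjective W hW b.fst x hx
  obtain ⟨W₂, h₂, hx₂, a₂, ha₂⟩ := φ.locally_surjective W hW b.snd x hx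
  obtain ⟨c₁, hc₁⟩ := φ.res_toSec_mem_range (inf_le_left : W₁ ⊓ W₂ ≤ W₁)
    (subset_trans h₁ hW) a₁
  obtain ⟨c₂, hc₂⟩ := φ.res_toSec_mem_range (inf_le_right : W₁ ⊓ W₂ ≤ W₂)
    (subset_trans h₂ hW) a₂
  rw [ha₁, X.res_res] at hc₁
  rw [ha₂, X.res_res] at hc₂
  obtain ⟨c, hc⟩ := (SuperFun.splitHom_bijective p hj (W₁ ⊓ W₂)).2 (OddExt.mk _ c₁ c₂)
  refine ⟨W₁ ⊓ W₂, inf_le_left.trans h₁, ⟨hx₁, hx₂⟩, c, OddExt.ext ?_ ?_⟩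
  · exact (congrArg (fun y => φ.toSec (W₁ ⊓ W₂) _ (OddExt.fst y)) hc).trans hc₁
  · exact (congrArg (fun y => φ.toSec (W₁ ⊓ W₂) _ (OddExt.snd y)) hc).trans hc₂

/-- A chart of `X` extends to a chart of `X[η]`, with `η` as the additional coordinate. -/
def oddExtension (φ : SuperChart X p) (j : ℤ) (hj : Odd j) :
    SuperChart (X.oddExtension j hj) (extDim p j) where
  e := φ.e
  toSec := φ.extToSec hj
  res_ofBody := φ.map_res_extToSec_ofBody hj
  res_coord := φ.map_res_extToSec_coord hj
  deg_ofBody := φ.extToSec_ofBody_mem_deg hj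
  deg_coord := φ.extToSec_coord_mem_deg hj
  eval_ofBody := φ.eval_fst_extToSec_ofBody hj
  eval_coord := φ.eval_fst_extToSec_coord hj
  injective := φ.extToSec_injective hj
  locally_surjective := φ.extToSec_locally_surjective hj

end SuperChart

namespace Supermanifold

/-- The supermanifold `S[η]`, the product of `S` with the line that has one coordinate `η` of odd
degree `-j`. -/
abbrev oddExtension (S : Supermanifold) (j : ℤ) (hj : Odd j) : Supermanifold where
  toGradedSpace := S.toGradedSpace.oddExtension j hj
  exists_chart := by
    obtain ⟨p, hp⟩ := S.exists_chart
    refine ⟨extDim p j, fun x => ?_⟩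
    obtain ⟨φ, hφ⟩ := hp x
    exact ⟨φ.oddExtension j hj, hφ⟩

end Supermanifold

namespace Supermanifold

/-! ### Odd derivations as morphisms -/

theorem DerivationAlong.map_mul_of_odd {S M : Supermanifold} {f : S ⟶ M} {j : ℤ} (hj : Odd j)
    (X : DerivationAlong f j) (q : OpenPair (Hom.base f)) (a b : M.sec q.tgt) :
    X.1 q (a * b) = X.1 q a * Hom.pull f q b + S.parity _ (Hom.pull f q a) * X.1 q b := by
  induction a using (M.isInternal q.tgt).induction_homogeneous with
  | hom i a ha =>
    rw [X.2.2.2 q i a b ha, S.parity_of_mem _ (Hom.pull_deg f q i a ha), negOnePow_odd_mul hj,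
      smul_mul_assoc]
  | add a a' ha ha' =>
    simp only [add_mul, map_add, ha, ha']
    abel

theorem DerivationAlong.map_one {S M : Supermanifold} {f : S ⟶ M} {j : ℤ}
    (X : DerivationAlong f j) (q : OpenPair (Hom.base f)) : X.1 q 1 = 0 := by
  have h := X.2.2.2 q 0 1 1 SetLike.GradedOne.one_mem
  simpa using h

/-- The morphism `S[η] ⟶ M` given by `a ↦ f^* a + η X a`, for an odd derivation `X` along
`f : S ⟶ M`. -/
def homOfDerivation {S M : Supermanifold} (f : S ⟶ M) {j : ℤ} (hj : Odd j)
    (X : DerivationAlong f j) : S.oddExtension j hj ⟶ M :=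
  show Hom (S.oddExtension j hj) M from
  { base := Hom.base (M := S) (N := M) f
    pull := fun q =>
      { toFun := fun a => OddExt.mk (S.parity q.src) (Hom.pull f q a) (X.1 q a)
        map_one' := OddExt.ext (map_one (Hom.pull f q)) (DerivationAlong.map_one X q)
        map_mul' := fun a b =>
          OddExt.ext (map_mul (Hom.pull f q) a b) (DerivationAlong.map_mul_of_odd hj X q a b)
        map_zero' := OddExt.ext (map_zero (Hom.pull f q)) (map_zero (X.1 q))
        map_add' := fun a b =>
          OddExt.ext (map_add (Hom.pull f q) a b) (map_add (X.1 q) a b)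
        commutes' := fun r => by
          refine Eq.trans ?_ (OddExt.algebraMap_eq r).symm
          refine OddExt.ext ((Hom.pull f q).commutes r) ?_
          change X.1 q (algebraMap ℝ _ r) = 0
          rw [Algebra.algebraMap_eq_smul_one, map_smul, DerivationAlong.map_one X, smul_zero] }
    pull_deg := fun q i a ha => OddExt.mem_deg.2 ⟨Hom.pull_deg f q i a ha, X.2.2.1 q i a ha⟩
    pull_res := fun q r ht hs a =>
      OddExt.ext (σ := S.parity r.src) (Hom.pull_res f q r ht hs a) (X.2.1 q r ht hs a)
    eval_pull := fun q a x => Hom.eval_pull f q a x }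

theorem homOfDerivation_comp {S M N : Supermanifold} (f : S ⟶ M) {j : ℤ} (hj : Odd j)
    (X : DerivationAlong f j) (h : M ⟶ N) :
    homOfDerivation f hj X ≫ h =
      homOfDerivation (f ≫ h) hj (DerivationAlong.postcomp f h j X) :=
  Hom.ext' rfl fun _ _ _ _ _ => rfl

/-- The restriction of a morphism `S[η] ⟶ M` to `η = 0`. -/
def restrictOdd {S M : Supermanifold} {j : ℤ} {hj : Odd j} (F : S.oddExtension j hj ⟶ M) :
    S ⟶ M :=
  show Hom S M from
  { base := Hom.base (M := S.oddExtension j hj) (N := M) F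
    pull := fun q => (OddExt.fstHom (S.parity q.src)).comp (Hom.pull F q)
    pull_deg := fun q i a ha => (Hom.pull_deg F q i a ha).1
    pull_res := fun q r ht hs a => congrArg (OddExt.fst (σ := S.parity r.src)) (Hom.pull_res F q r ht hs a)
    eval_pull := fun q a x => Hom.eval_pull F q a x }

/-- The `η`-component of a morphism `S[η] ⟶ M`, a derivation along its restriction to `η = 0`. -/
def derivationOfHom {S M : Supermanifold} {j : ℤ} {hj : Odd j} (F : S.oddExtension j hj ⟶ M) :
    DerivationAlong (restrictOdd F) j :=
  ⟨fun q => (OddExt.snd (σ := S.parity q.src)) ∘ₗ (Hom.pull F q).toLinearMap, by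
    refine ⟨fun q r ht hs a => ?_, fun q i a ha => ?_, fun q i a b ha => ?_⟩
    · exact congrArg (OddExt.snd (σ := S.parity r.src)) (Hom.pull_res F q r ht hs a)
    · exact (Hom.pull_deg F q i a ha).2
    · have hfst : OddExt.fst (Hom.pull F q a) ∈ S.deg q.src i := (Hom.pull_deg F q i a ha).1
      refine (congrArg (OddExt.snd (σ := S.parity q.src)) (map_mul (Hom.pull F q) a b)).trans ?_
      refine (OddExt.snd_mul (σ := S.parity q.src) _ _).trans ?_
      rw [S.parity_of_mem _ hfst, negOnePow_odd_mul hj, smul_mul_assoc]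
      rfl⟩

theorem homOfDerivation_injective {S M : Supermanifold} {f g : S ⟶ M} {j : ℤ} {hj : Odd j}
    {X : DerivationAlong f j} {Y : DerivationAlong g j}
    (h : homOfDerivation f hj X = homOfDerivation g hj Y) :
    ∃ hfg : f = g, hfg ▸ X = Y := by
  have hfg : f = g := congrArg restrictOdd h
  subst hfg
  refine ⟨rfl, Subtype.ext (funext fun q => LinearMap.ext fun a => ?_)⟩
  have key : ∀ (F G : S.oddExtension j hj ⟶ M) (_ : F = G) (V : Opens M.carrier)
      (U : Opens S.carrier) (hF : ∀ x ∈ U, Hom.base F x ∈ V) (hG : ∀ x ∈ U, Hom.base G x ∈ V)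
      (a : M.sec V), OddExt.snd (σ := S.parity U) (Hom.pull F ⟨V, U, hF⟩ a) =
        OddExt.snd (σ := S.parity U) (Hom.pull G ⟨V, U, hG⟩ a) := by
    rintro F _ rfl V U _ _ a
    rfl
  exact key _ _ h q.tgt q.src q.le q.le a

/-! ### Shifting even derivations to odd ones -/

/-- The composite of the projection `S[η] ⟶ S` with `f : S ⟶ M`. -/
def extendConst {S M : Supermanifold} {j : ℤ} (hj : Odd j) (f : S ⟶ M) :
    S.oddExtension j hj ⟶ M :=
  show Hom (S.oddExtension j hj) M from
  { base := Hom.base (M := S) (N := M) f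
    pull := fun q => (OddExt.inl (S.parity q.src)).comp (Hom.pull f q)
    pull_deg := fun q i a ha => OddExt.mem_deg.2 ⟨Hom.pull_deg f q i a ha, zero_mem _⟩
    pull_res := fun q r ht hs a =>
      OddExt.ext (σ := S.parity r.src) (Hom.pull_res f q r ht hs a) (map_zero (S.res hs)).symm
    eval_pull := fun q a x => Hom.eval_pull f q a x }

/-- The derivation `η X` along `S[η] ⟶ S ⟶ M`, for a derivation `X` along `S ⟶ M`. -/
def etaMul {S M : Supermanifold} {f : S ⟶ M} {j k : ℤ} (hj : Odd j)
    (X : DerivationAlong f (j + k)) : DerivationAlong (extendConst hj f) k :=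
  ⟨fun q =>
    { toFun := fun a => OddExt.mk (S.parity q.src) 0 (X.1 q a)
      map_add' := fun a b => OddExt.ext (add_zero 0).symm (map_add (X.1 q) a b)
      map_smul' := fun r a => OddExt.ext (smul_zero r).symm (map_smul (X.1 q) r a) }, by
    refine ⟨fun q r ht hs a => ?_, fun q i a ha => ?_, fun q i a b ha => ?_⟩
    · exact OddExt.ext (σ := S.parity r.src) (map_zero (S.res hs)).symm (X.2.1 q r ht hs a)
    · refine OddExt.mem_deg.2 ⟨zero_mem _, ?_⟩
      rw [← add_assoc]
      exact X.2.2.1 q i a ha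
    · refine OddExt.ext (σ := S.parity q.src) ?_ ?_
      · change 0 = 0 * Hom.pull f q b + ((k * i).negOnePow : ℤ) • (Hom.pull f q a * 0)
        rw [zero_mul, mul_zero, smul_zero, add_zero]
      · change X.1 q (a * b) = X.1 q a * Hom.pull f q b + S.parity _ 0 * 0 +
          ((k * i).negOnePow : ℤ) • (0 * 0 + S.parity _ (Hom.pull f q a) * X.1 q b)
        rw [X.2.2.2 q i a b ha, S.parity_of_mem _ (Hom.pull_deg f q i a ha), mul_zero, add_zero,
          mul_zero, zero_add, smul_mul_assoc, smul_smul, ← Units.val_mul, add_mul,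
          Int.negOnePow_add, negOnePow_odd_mul hj, mul_comm (i.negOnePow)]⟩

/-- The `η`-component of a derivation along `S[η] ⟶ S ⟶ M`. -/
def etaComponent {S M : Supermanifold} {f : S ⟶ M} {j k : ℤ} (hj : Odd j)
    (Y : DerivationAlong (extendConst hj f) k) : DerivationAlong f (j + k) :=
  ⟨fun q => (OddExt.snd (σ := S.parity q.src)) ∘ₗ Y.1 q, by
    refine ⟨fun q r ht hs a => ?_, fun q i a ha => ?_, fun q i a b ha => ?_⟩
    · exact congrArg (OddExt.snd (σ := S.parity r.src)) (Y.2.1 q r ht hs a)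
    · have := (Y.2.2.1 q i a ha).2
      rw [← add_assoc] at this
      exact this
    · refine (congrArg (OddExt.snd (σ := S.parity q.src)) (Y.2.2.2 q i a b ha)).trans ?_
      change OddExt.snd (σ := S.parity q.src) (Y.1 q a) * Hom.pull f q b +
        S.parity q.src (OddExt.fst (σ := S.parity q.src) (Y.1 q a)) * 0 +
        ((k * i).negOnePow : ℤ) •
          (0 * OddExt.fst (σ := S.parity q.src) (Y.1 q b) + S.parity _ (Hom.pull f q a) *
            OddExt.snd (σ := S.parity q.src) (Y.1 q b)) = _
      rw [S.parity_of_mem _ (Hom.pull_deg f q i a ha), mul_zero, add_zero, zero_mul, zero_add,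
        smul_mul_assoc, smul_smul, ← Units.val_mul, add_mul j, Int.negOnePow_add,
        negOnePow_odd_mul hj, mul_comm (i.negOnePow)]
      rfl⟩

theorem etaMul_injective {S M : Supermanifold} {f : S ⟶ M} {j k : ℤ} (hj : Odd j) :
    Function.Injective (etaMul (f := f) (k := k) hj) := fun X Y h =>
  (congrArg (etaComponent hj) h : etaComponent hj (etaMul hj X) = etaComponent hj (etaMul hj Y))

/-! ### Lifting derivations to a pullback -/

theorem odd_of_even_one_add {k : ℤ} (h : Even (1 + k)) : Odd k := by
  rw [Int.even_add] at h
  exact Int.not_even_iff_odd.1 fun hk => absurd (h.2 hk) (by decide)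

section Pullback

variable {P A B C : Supermanifold} {p₁ : P ⟶ A} {p₂ : P ⟶ B} {s : A ⟶ C} {t : B ⟶ C}

/-- An odd derivation along `f` is a morphism from `S[η]`, so that the universal property of the
pullback, applied to `S[η]`, provides the lift. -/
theorem exists_derivation_lift_of_odd (h : IsPullback p₁ p₂ s t) {S : Supermanifold}
    (f : S ⟶ P) {j : ℤ} (hj : Odd j) (X : DerivationAlong (f ≫ p₁) j)
    (Y : DerivationAlong (f ≫ p₂) j)
    (hXY : ∀ V U h h' a, (DerivationAlong.postcomp (f ≫ p₁) s j X).1 ⟨V, U, h⟩ a =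
      (DerivationAlong.postcomp (f ≫ p₂) t j Y).1 ⟨V, U, h'⟩ a) :
    ∃ Z : DerivationAlong f j, DerivationAlong.postcomp f p₁ j Z = X ∧
      DerivationAlong.postcomp f p₂ j Z = Y := by
  have hw : (f ≫ p₁) ≫ s = (f ≫ p₂) ≫ t := by rw [Category.assoc, Category.assoc, h.w]
  have key : ∀ (g k : S ⟶ C) (_ : g = k) (X : DerivationAlong g j) (Y : DerivationAlong k j),
      (∀ V U h h' a, X.1 ⟨V, U, h⟩ a = Y.1 ⟨V, U, h'⟩ a) →
      homOfDerivation g hj X = homOfDerivation k hj Y := by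
    rintro g _ rfl X Y hXY
    rw [show X = Y from Subtype.ext (funext fun q => LinearMap.ext fun a =>
      hXY q.tgt q.src q.le q.le a)]
  have hF : homOfDerivation (f ≫ p₁) hj X ≫ s = homOfDerivation (f ≫ p₂) hj Y ≫ t := by
    rw [homOfDerivation_comp, homOfDerivation_comp]
    exact key _ _ hw _ _ hXY
  obtain ⟨L, hL₁, hL₂⟩ : ∃ L : S.oddExtension j hj ⟶ P,
      L ≫ p₁ = homOfDerivation (f ≫ p₁) hj X ∧ L ≫ p₂ = homOfDerivation (f ≫ p₂) hj Y :=
    ⟨h.lift _ _ hF, h.lift_fst _ _ hF, h.lift_snd _ _ hF⟩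
  -- At `η = 0` the lift has the same components as `f`.
  have hLf : restrictOdd L = f := h.hom_ext (congrArg restrictOdd hL₁) (congrArg restrictOdd hL₂)
  have hL : homOfDerivation (restrictOdd L) hj (derivationOfHom L) = L :=
    Hom.ext' rfl fun _ _ _ _ _ => rfl
  obtain ⟨g, Z, hgf, rfl⟩ : ∃ (g : S ⟶ P) (Z : DerivationAlong g j), g = f ∧
    homOfDerivation g hj Z = L := ⟨_, derivationOfHom L, hLf, hL⟩
  subst hgf
  rw [homOfDerivation_comp] at hL₁ hL₂
  obtain ⟨_, h₁⟩ := homOfDerivation_injective hL₁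
  obtain ⟨_, h₂⟩ := homOfDerivation_injective hL₂
  exact ⟨Z, h₁, h₂⟩

/-- Compatible derivations along the two components of a morphism to a pullback come from a
derivation along the morphism itself. -/
theorem exists_derivation_lift (h : IsPullback p₁ p₂ s t) {S : Supermanifold}
    (f : S ⟶ P) {j : ℤ} (X : DerivationAlong (f ≫ p₁) j) (Y : DerivationAlong (f ≫ p₂) j)
    (hXY : ∀ V U h h' a, (DerivationAlong.postcomp (f ≫ p₁) s j X).1 ⟨V, U, h⟩ a =
      (DerivationAlong.postcomp (f ≫ p₂) t j Y).1 ⟨V, U, h'⟩ a) :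
    ∃ Z : DerivationAlong f j, DerivationAlong.postcomp f p₁ j Z = X ∧
      DerivationAlong.postcomp f p₂ j Z = Y := by
  rcases Int.even_or_odd j with hj | hj
  · -- Multiplication by an odd `η` of degree `-1` makes the derivations odd.
    obtain ⟨k, rfl⟩ : ∃ k, j = 1 + k := ⟨j - 1, by ring⟩
    have hk : Odd k := odd_of_even_one_add hj
    obtain ⟨Z, hZ₁, hZ₂⟩ := exists_derivation_lift_of_odd h (extendConst odd_one f) hk
      (etaMul odd_one X) (etaMul odd_one Y) fun V U hV hV' a =>
        OddExt.ext (σ := S.parity U) rfl (hXY V U hV hV' a)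
    exact ⟨etaComponent odd_one Z, congrArg (etaComponent (f := f ≫ p₁) odd_one) hZ₁,
      congrArg (etaComponent (f := f ≫ p₂) odd_one) hZ₂⟩
  · exact exists_derivation_lift_of_odd h f hj X Y hXY

end Pullback

/-! ### Tangent points -/

theorem TangentPoint.congr_apply {M S : Supermanifold} {x y : TangentPoint M S} (h : x = y)
    (j : ℤ) (V : Opens M.carrier) (U : Opens S.carrier) (hx : ∀ s ∈ U, Hom.base x.pt s ∈ V)
    (hy : ∀ s ∈ U, Hom.base y.pt s ∈ V) (a : M.sec V) :
    (x.vec j).1 ⟨V, U, hx⟩ a = (y.vec j).1 ⟨V, U, hy⟩ a := by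
  subst h
  rfl

/-- Tangent points are separated by the natural maps to the points over other supermanifolds:
for odd `j` their components of degree `j` are seen over `S[η]`, for even `j` over `S[η, η']`. -/
theorem TangentPoint.eq_of_natural {M S : Supermanifold} (x y : TangentPoint M S)
    (h : ∀ (Q : Supermanifold) (τ : ∀ N : Supermanifold, TangentPoint N S → (Q ⟶ N)),
      (∀ (N N' : Supermanifold) (k : N ⟶ N') (z : TangentPoint N S),
        τ N' (z.postcomp k) = τ N z ≫ k) → τ M x = τ M y) : x = y := by
  have hodd : ∀ {j : ℤ} (hj : Odd j),
      homOfDerivation x.pt hj (x.vec j) = homOfDerivation y.pt hj (y.vec j) := fun {j} hj =>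
    h _ (fun N z => homOfDerivation z.pt hj (z.vec j)) fun N N' k z =>
      (homOfDerivation_comp z.pt hj (z.vec j) k).symm
  have heven : ∀ {k : ℤ} (hk : Odd k),
      homOfDerivation (extendConst odd_one x.pt) hk (etaMul odd_one (x.vec (1 + k))) =
        homOfDerivation (extendConst odd_one y.pt) hk (etaMul odd_one (y.vec (1 + k))) :=
    fun {k} hk => h _ (fun N z => homOfDerivation (extendConst odd_one z.pt) hk
      (etaMul odd_one (z.vec (1 + k)))) fun N N' l z =>
        (homOfDerivation_comp (extendConst odd_one z.pt) hk (etaMul odd_one (z.vec (1 + k))) l).symm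
  obtain ⟨f, X⟩ := x
  obtain ⟨g, Y⟩ := y
  obtain rfl : f = g := (homOfDerivation_injective (hodd odd_one)).1
  congr 1
  refine DFinsupp.ext fun j => ?_
  rcases Int.even_or_odd j with hj | hj
  · obtain ⟨k, rfl⟩ : ∃ k, j = 1 + k := ⟨j - 1, by ring⟩
    have hk : Odd k := odd_of_even_one_add hj
    exact etaMul_injective odd_one (homOfDerivation_injective (heven hk)).2
  · exact (homOfDerivation_injective (hodd hj)).2

theorem TangentPoint.postcomp_mk {M N S : Supermanifold} (f : S ⟶ M)
    (X : ⨁ j : ℤ, DerivationAlong f j) (h : M ⟶ N) (Y : ⨁ j : ℤ, DerivationAlong (f ≫ h) j)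
    (hXY : ∀ j, DerivationAlong.postcomp f h j (X j) = Y j) :
    (TangentPoint.mk f X).postcomp h = ⟨f ≫ h, Y⟩ :=
  congrArg (TangentPoint.mk (f ≫ h)) (DFinsupp.ext hXY)

/-- Compatible tangent points come from a tangent point of the pullback; its vector is a finite sum
because the components in the degrees where both given vectors vanish can be chosen to be zero. -/
theorem TangentPoint.exists_lift {P A B C : Supermanifold} {p₁ : P ⟶ A} {p₂ : P ⟶ B}
    {s : A ⟶ C} {t : B ⟶ C} (h : IsPullback p₁ p₂ s t) {S : Supermanifold}
    (x : TangentPoint A S) (y : TangentPoint B S) (hxy : x.postcomp s = y.postcomp t) :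
    ∃ z : TangentPoint P S, z.postcomp p₁ = x ∧ z.postcomp p₂ = y := by
  classical
  obtain ⟨g, X⟩ := x
  obtain ⟨k, Y⟩ := y
  have hgk : g ≫ s = k ≫ t := congrArg TangentPoint.pt hxy
  obtain ⟨f, rfl, rfl⟩ : ∃ f, f ≫ p₁ = g ∧ f ≫ p₂ = k :=
    ⟨h.lift g k hgk, h.lift_fst _ _ _, h.lift_snd _ _ _⟩
  choose Z hZ₁ hZ₂ using fun j => exists_derivation_lift h f (X j) (Y j)
    (TangentPoint.congr_apply hxy j)
  have hZ : ∀ j, j ∉ DFinsupp.support X ∪ DFinsupp.support Y → X j = 0 ∧ Y j = 0 := by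
    intro j hj
    rwa [Finset.mem_union, not_or, DFinsupp.notMem_support_iff, DFinsupp.notMem_support_iff] at hj
  refine ⟨⟨f, DirectSum.mk _ (DFinsupp.support X ∪ DFinsupp.support Y) fun j => Z j⟩,
    TangentPoint.postcomp_mk _ _ _ _ fun j => ?_, TangentPoint.postcomp_mk _ _ _ _ fun j => ?_⟩
  · by_cases hj : j ∈ DFinsupp.support X ∪ DFinsupp.support Y
    · rw [DirectSum.mk_apply_of_mem hj]
      exact hZ₁ j
    · rw [DirectSum.mk_apply_of_notMem hj, map_zero, (hZ j hj).1]
  · by_cases hj : j ∈ DFinsupp.support X ∪ DFinsupp.support Y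
    · rw [DirectSum.mk_apply_of_mem hj]
      exact hZ₂ j
    · rw [DirectSum.mk_apply_of_notMem hj, map_zero, (hZ j hj).2]

end Supermanifold

/-! ### Groupoid objects -/

namespace GroupoidData.IsGroupoid

section

variable {C : Type u} [Category.{v} C] {G : GroupoidData C} {T : C}

theorem one_mul (h : G.IsGroupoid) (a b : T ⟶ G.mor) (hb : b = a ≫ G.t ≫ G.e)
    (hab : b ≫ G.s = a ≫ G.t) : h.isPullback.lift b a hab ≫ G.m = a := by
  have : h.isPullback.lift b a hab = a ≫ h.isPullback.lift (G.t ≫ G.e) (𝟙 G.mor)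
      (by rw [Category.assoc, h.e_s, Category.comp_id, Category.id_comp]) :=
    h.isPullback.hom_ext (by simp [hb]) (by simp)
  rw [this, Category.assoc, h.e_m, Category.comp_id]

theorem mul_one (h : G.IsGroupoid) (a b : T ⟶ G.mor) (hb : b = a ≫ G.s ≫ G.e)
    (hab : a ≫ G.s = b ≫ G.t) : h.isPullback.lift a b hab ≫ G.m = a := by
  have : h.isPullback.lift a b hab = a ≫ h.isPullback.lift (𝟙 G.mor) (G.s ≫ G.e)
      (by rw [Category.assoc, h.e_t, Category.comp_id, Category.id_comp]) :=
    h.isPullback.hom_ext (by simp) (by simp [hb])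
  rw [this, Category.assoc, h.m_e, Category.comp_id]

theorem inv_mul (h : G.IsGroupoid) (a : T ⟶ G.mor) (ha : (a ≫ G.i) ≫ G.s = a ≫ G.t) :
    h.isPullback.lift (a ≫ G.i) a ha ≫ G.m = a ≫ G.s ≫ G.e := by
  have : h.isPullback.lift (a ≫ G.i) a ha = a ≫ h.isPullback.lift G.i (𝟙 G.mor)
      (by rw [h.i_s, Category.id_comp]) :=
    h.isPullback.hom_ext (by simp) (by simp)
  rw [this, Category.assoc, h.i_m]

theorem mul_inv (h : G.IsGroupoid) (a : T ⟶ G.mor) (ha : a ≫ G.s = (a ≫ G.i) ≫ G.t) :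
    h.isPullback.lift a (a ≫ G.i) ha ≫ G.m = a ≫ G.t ≫ G.e := by
  have : h.isPullback.lift a (a ≫ G.i) ha = a ≫ h.isPullback.lift (𝟙 G.mor) G.i
      (by rw [h.i_t, Category.id_comp]) :=
    h.isPullback.hom_ext (by simp) (by simp)
  rw [this, Category.assoc, h.m_i]

theorem lift_congr (h : G.IsGroupoid) {a b a' b' : T ⟶ G.mor} (ha : a = a') (hb : b = b')
    (hab : a ≫ G.s = b ≫ G.t) (hab' : a' ≫ G.s = b' ≫ G.t) :
    h.isPullback.lift a b hab = h.isPullback.lift a' b' hab' := by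
  subst ha hb
  rfl

/-- An idempotent of a groupoid is a unit. -/
theorem eq_unit_of_mul_self (h : G.IsGroupoid) (u : T ⟶ G.mor) (hu : u ≫ G.s = u ≫ G.t)
    (huu : h.isPullback.lift u u hu ≫ G.m = u) : u = u ≫ G.s ≫ G.e := by
  have hi : (u ≫ G.i) ≫ G.s = u ≫ G.t := by rw [Category.assoc, h.i_s]
  have key := h.assoc (u ≫ G.i) u u hi hu
  rw [h.lift_congr (h.inv_mul u hi) rfl _
    (by rw [Category.assoc, Category.assoc, h.e_s, Category.comp_id, hu]),
    h.one_mul _ _ (by rw [← Category.assoc, hu, Category.assoc]),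
    h.lift_congr rfl huu _ hi, h.inv_mul u hi] at key
  exact key

/-- A left inverse in a groupoid is the inverse. -/
theorem eq_inv_of_mul_eq_unit (h : G.IsGroupoid) (a b : T ⟶ G.mor) (hab : a ≫ G.s = b ≫ G.t)
    (hm : h.isPullback.lift a b hab ≫ G.m = b ≫ G.s ≫ G.e) : a = b ≫ G.i := by
  have hi : b ≫ G.s = (b ≫ G.i) ≫ G.t := by rw [Category.assoc, h.i_t]
  have key := h.assoc a b (b ≫ G.i) hab hi
  rw [h.lift_congr hm rfl _
    (by rw [Category.assoc, Category.assoc, h.e_s, Category.comp_id, hi]),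
    h.one_mul _ _ (by simp only [Category.assoc, reassoc_of% h.i_t]),
    h.lift_congr rfl (h.mul_inv b hi) _
      (by rw [Category.assoc, Category.assoc, h.e_t, Category.comp_id, hab]),
    h.mul_one _ _ (by rw [← Category.assoc, ← hab, Category.assoc])] at key
  exact key.symm

/-- A map that is compatible with source, target and multiplication, the latter through some map
between the objects of composable pairs, is a morphism of groupoids: the map on objects is
recovered by multiplying with units, units go to idempotents, and inverses to inverses. -/
theorem isMorphism_of_comp {H : GroupoidData C} (hG : G.IsGroupoid) (hH : H.IsGroupoid)
    (φ : G.mor ⟶ H.mor) (φ₂ : G.comp ⟶ H.comp) (h₁ : φ₂ ≫ H.p₁ = G.p₁ ≫ φ)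
    (h₂ : φ₂ ≫ H.p₂ = G.p₂ ≫ φ) (hm : φ₂ ≫ H.m = G.m ≫ φ) : G.IsMorphism H hH φ := by
  have hφ : G.p₁ ≫ φ ≫ H.s = G.p₂ ≫ φ ≫ H.t := by
    rw [← reassoc_of% h₁, ← reassoc_of% h₂, H.composable]
  -- Evaluate compatibility on the composable pairs `(g, 1)` and `(1, g)`.
  have hs : φ ≫ H.s = G.s ≫ G.e ≫ φ ≫ H.t := by
    have hr : 𝟙 G.mor ≫ G.s = (G.s ≫ G.e) ≫ G.t := by
      rw [Category.assoc, hG.e_t, Category.comp_id, Category.id_comp]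
    simpa using congrArg (hG.isPullback.lift (𝟙 G.mor) (G.s ≫ G.e) hr ≫ ·) hφ
  have hs' : G.e ≫ φ ≫ H.s = G.e ≫ φ ≫ H.t := by
    rw [hs, reassoc_of% hG.e_s]
  have ht : φ ≫ H.t = G.t ≫ G.e ≫ φ ≫ H.t := by
    have hr : (G.t ≫ G.e) ≫ G.s = 𝟙 G.mor ≫ G.t := by
      rw [Category.assoc, hG.e_s, Category.comp_id, Category.id_comp]
    have := congrArg (hG.isPullback.lift (G.t ≫ G.e) (𝟙 G.mor) hr ≫ ·) hφ
    simp only [IsPullback.lift_fst_assoc, IsPullback.lift_snd_assoc, Category.assoc,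
      Category.id_comp] at this
    rw [← hs']
    exact this.symm
  have hmul : ∀ {T : C} (a b : T ⟶ G.mor) (hab : a ≫ G.s = b ≫ G.t)
      (hab' : (a ≫ φ) ≫ H.s = (b ≫ φ) ≫ H.t),
      hH.isPullback.lift (a ≫ φ) (b ≫ φ) hab' ≫ H.m =
        (hG.isPullback.lift a b hab ≫ G.m) ≫ φ := by
    intro T a b hab hab'
    have : hH.isPullback.lift (a ≫ φ) (b ≫ φ) hab' = hG.isPullback.lift a b hab ≫ φ₂ :=
      hH.isPullback.hom_ext (by simp [h₁]) (by simp [h₂])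
    rw [this, Category.assoc, hm, Category.assoc]
  have hunit : G.e ≫ φ = (G.e ≫ φ ≫ H.t) ≫ H.e := by
    have hee : G.e ≫ G.s = G.e ≫ G.t := by rw [hG.e_s, hG.e_t]
    have hee' : (G.e ≫ φ) ≫ H.s = (G.e ≫ φ) ≫ H.t := by simpa using hs'
    have h1 := hmul G.e G.e hee hee'
    rw [hG.one_mul G.e G.e (by rw [reassoc_of% hG.e_t]) hee] at h1
    rw [← hs']
    simpa using hH.eq_unit_of_mul_self (G.e ≫ φ) hee' h1
  refine ⟨G.e ≫ φ ≫ H.t, hs, ht, ?_, hunit, ?_⟩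
  · have : hH.isPullback.lift (G.p₁ ≫ φ) (G.p₂ ≫ φ) (by simpa using hφ) = φ₂ :=
      hH.isPullback.hom_ext (by simp [h₁]) (by simp [h₂])
    rw [this, hm]
  · have hi : G.i ≫ G.s = 𝟙 G.mor ≫ G.t := by rw [hG.i_s, Category.id_comp]
    have hi' : (G.i ≫ φ) ≫ H.s = (𝟙 G.mor ≫ φ) ≫ H.t := by
      rw [Category.assoc, hs, reassoc_of% hG.i_s, Category.id_comp, ← ht]
    have hi'' : (G.i ≫ φ) ≫ H.s = φ ≫ H.t := by rw [hi', Category.id_comp]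
    have h1 := hmul G.i (𝟙 G.mor) hi hi'
    rw [hG.i_m, hH.lift_congr rfl (Category.id_comp φ) hi' hi'', Category.assoc, hunit] at h1
    refine hH.eq_inv_of_mul_eq_unit _ _ hi'' (h1.trans ?_)
    rw [reassoc_of% hs]
    simp only [Category.assoc]

theorem exists_comp_of_isMorphism {H : GroupoidData C} (hH : H.IsGroupoid) {φ : G.mor ⟶ H.mor}
    (hφ : G.IsMorphism H hH φ) : ∃ φ₂ : G.comp ⟶ H.comp,
      φ₂ ≫ H.p₁ = G.p₁ ≫ φ ∧ φ₂ ≫ H.p₂ = G.p₂ ≫ φ ∧ φ₂ ≫ H.m = G.m ≫ φ := by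
  obtain ⟨φ₀, hs, ht, hm, -, -⟩ := hφ
  exact ⟨_, hH.isPullback.lift_fst _ _ _, hH.isPullback.lift_snd _ _ _, hm⟩

end

theorem map_lift_comp_m {C : Type u} [Category.{v} C] {D : Type u'} [Category.{v'} D]
    {G : GroupoidData C} (hG : G.IsGroupoid) (F : C ⥤ D)
    (hF : IsPullback (F.map G.p₁) (F.map G.p₂) (F.map G.s) (F.map G.t)) {T : C}
    {a b : T ⟶ G.mor} (hab : a ≫ G.s = b ≫ G.t) {a' b' : F.obj T ⟶ F.obj G.mor}
    (ha : a' = F.map a) (hb : b' = F.map b) (hab' : a' ≫ F.map G.s = b' ≫ F.map G.t) :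
    hF.lift a' b' hab' ≫ F.map G.m = F.map (hG.isPullback.lift a b hab ≫ G.m) := by
  subst ha hb
  have : hF.lift _ _ hab' = F.map (hG.isPullback.lift a b hab) :=
    hF.hom_ext (by rw [IsPullback.lift_fst, ← F.map_comp, IsPullback.lift_fst])
      (by rw [IsPullback.lift_snd, ← F.map_comp, IsPullback.lift_snd])
  rw [this, F.map_comp]

/-- A functor with values in presheaves that preserves the pullback of composable pairs maps a
groupoid object to a groupoid object, provided that the elements of its values are separated by
natural maps to morphisms in the source category.  Associativity, which involves arbitrary triples
of elements, is the law for which the separation is needed. -/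
theorem map {C : Type u} [Category.{v} C] {E : Type u'} [Category.{v'} E]
    {G : GroupoidData C} (hG : G.IsGroupoid) (F : C ⥤ E ⥤ Type v)
    (hF : IsPullback (F.map G.p₁) (F.map G.p₂) (F.map G.s) (F.map G.t))
    (hsep : ∀ (S : E) (M : C) (x y : (F.obj M).obj S),
      (∀ (Q : C) (τ : ∀ N : C, (F.obj N).obj S → (Q ⟶ N)),
        (∀ (N N' : C) (k : N ⟶ N') (z : (F.obj N).obj S),
          τ N' ((F.map k).app S z) = τ N z ≫ k) → τ M x = τ M y) → x = y) :
    (G.map F).IsGroupoid where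
  isPullback := hF
  m_s := by
    change F.map _ ≫ F.map _ = F.map _ ≫ F.map _
    rw [← F.map_comp, ← F.map_comp, hG.m_s]
  m_t := by
    change F.map _ ≫ F.map _ = F.map _ ≫ F.map _
    rw [← F.map_comp, ← F.map_comp, hG.m_t]
  e_s := by
    change F.map _ ≫ F.map _ = 𝟙 (F.obj _)
    rw [← F.map_comp, hG.e_s, F.map_id]
  e_t := by
    change F.map _ ≫ F.map _ = 𝟙 (F.obj _)
    rw [← F.map_comp, hG.e_t, F.map_id]
  i_s := by
    change F.map _ ≫ F.map _ = F.map _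
    rw [← F.map_comp, hG.i_s]
  i_t := by
    change F.map _ ≫ F.map _ = F.map _
    rw [← F.map_comp, hG.i_t]
  assoc := by
    intro T a b c hab hbc
    ext S x
    refine hsep S _ _ _ fun Q τ hτ => ?_
    have hcond : ∀ {u v : T ⟶ F.obj G.mor}, u ≫ F.map G.s = v ≫ F.map G.t →
        τ _ (u.app S x) ≫ G.s = τ _ (v.app S x) ≫ G.t := by
      intro u v huv
      rw [← hτ, ← hτ]
      exact congrArg (τ _) (congrArg (fun w => w.app S x) huv)
    have key : ∀ (u v : T ⟶ F.obj G.mor) (huv : u ≫ F.map G.s = v ≫ F.map G.t)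
        (α β : Q ⟶ G.mor) (_ : τ _ (u.app S x) = α) (_ : τ _ (v.app S x) = β)
        (hαβ : α ≫ G.s = β ≫ G.t),
        τ _ ((hF.lift u v huv ≫ F.map G.m).app S x) = hG.isPullback.lift α β hαβ ≫ G.m := by
      rintro u v huv _ _ rfl rfl hαβ
      refine (hτ _ _ _ _).trans (congrArg (· ≫ G.m) (hG.isPullback.hom_ext ?_ ?_))
      · rw [IsPullback.lift_fst, ← hτ]
        exact congrArg (τ _) (congrArg (fun w => w.app S x) (hF.lift_fst u v huv))
      · rw [IsPullback.lift_snd, ← hτ]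
        exact congrArg (τ _) (congrArg (fun w => w.app S x) (hF.lift_snd u v huv))
    refine (key _ _ _ _ _ (key a b hab _ _ rfl rfl (hcond hab)) rfl ?_).trans
      (Eq.trans ?_ (key _ _ _ _ _ rfl (key b c hbc _ _ rfl rfl (hcond hbc)) ?_).symm)
    · rw [Category.assoc, hG.m_s, IsPullback.lift_snd_assoc]
      exact hcond hbc
    · exact hG.assoc _ _ _ (hcond hab) (hcond hbc)
  e_m := (hG.map_lift_comp_m F hF _ (F.map_comp _ _).symm (F.map_id _).symm _).trans
    (by rw [hG.e_m, F.map_id]; rfl)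
  m_e := (hG.map_lift_comp_m F hF _ (F.map_id _).symm (F.map_comp _ _).symm _).trans
    (by rw [hG.m_e, F.map_id]; rfl)
  i_m := (hG.map_lift_comp_m F hF _ rfl (F.map_id _).symm _).trans
    (by rw [hG.i_m, F.map_comp]; rfl)
  m_i := (hG.map_lift_comp_m F hF _ (F.map_id _).symm rfl _).trans
    (by rw [hG.m_i, F.map_comp]; rfl)

end GroupoidData.IsGroupoid

namespace Supermanifold

/-! ### Pullbacks of tangent bundles -/

theorem isPullback_tangentFunctor_map {P A B C : Supermanifold} {p₁ : P ⟶ A} {p₂ : P ⟶ B}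
    {s : A ⟶ C} {t : B ⟶ C} (h : IsPullback p₁ p₂ s t) :
    IsPullback (tangentFunctor.map p₁) (tangentFunctor.map p₂) (tangentFunctor.map s)
      (tangentFunctor.map t) := by
  refine IsPullback.of_forall_isPullback_app fun S => ?_
  refine (Limits.Types.isPullback_iff _ _ _ _).2 ⟨?_, ?_, ?_⟩
  · rw [← NatTrans.comp_app, ← NatTrans.comp_app, ← Functor.map_comp, ← Functor.map_comp, h.w]
  · rintro (x : TangentPoint P S.unop) (y : TangentPoint P S.unop) ⟨h₁, h₂⟩
    refine TangentPoint.eq_of_natural x y fun Q τ hτ => h.hom_ext ?_ ?_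
    · rw [← hτ, ← hτ]
      exact congrArg (τ A) h₁
    · rw [← hτ, ← hτ]
      exact congrArg (τ B) h₂
  · intro x y hxy
    exact TangentPoint.exists_lift h x y hxy

/-! ### Vector fields as sections -/

/-- A vector field as a tangent point over the identity. -/
def VectorField.toPoint {M : Supermanifold} (X : VectorField M) : TangentPoint M M :=
  ⟨𝟙 M, DirectSum.lmap (VectorFieldOfDegree.along M) X⟩

/-- Tangent points over the identity are vector fields. -/
theorem VectorField.exists_toPoint_eq {M : Supermanifold} (x : TangentPoint M M)
    (hx : x.pt = 𝟙 M) : ∃ X : VectorField M, X.toPoint = x := by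
  obtain ⟨f, Y⟩ := x
  obtain rfl : f = 𝟙 M := hx
  have hY : ∀ j, ∃ Z : VectorFieldOfDegree M j, VectorFieldOfDegree.along M j Z = Y j := by
    intro j
    have h1 := (Y j).2.1
    refine ⟨⟨fun U => (Y j).1 ⟨U, U, fun x hx => hx⟩, ?_, ?_, ?_⟩, ?_⟩
    · intro U V h a
      exact h1 ⟨V, V, fun x hx => hx⟩ ⟨U, U, fun x hx => hx⟩ h h a
    · intro U i a ha
      exact (Y j).2.2.1 ⟨U, U, fun x hx => hx⟩ i a ha
    · intro U i a b ha
      refine ((Y j).2.2.2 ⟨U, U, fun x hx => hx⟩ i a b ha).trans ?_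
      have hid : ∀ c : M.sec U, Hom.pull (𝟙 M) ⟨U, U, fun x hx => hx⟩ c = c := M.res_refl U
      rw [hid, hid]
    · refine Subtype.ext (funext fun q => LinearMap.ext fun a => ?_)
      refine (h1 ⟨q.tgt, q.tgt, fun x hx => hx⟩ q le_rfl (OpenPair.le_of_id q) a).symm.trans ?_
      exact congrArg ((Y j).1 q) (M.res_refl _ a)
  choose Z hZ using hY
  classical
  refine ⟨DirectSum.mk _ (DFinsupp.support Y) fun j => Z j,
    congrArg (TangentPoint.mk (𝟙 M)) (DFinsupp.ext fun j => ?_)⟩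
  rw [DirectSum.lmap_apply]
  by_cases hj : j ∈ DFinsupp.support Y
  · rw [DirectSum.mk_apply_of_mem hj]
    exact hZ j
  · rw [DirectSum.mk_apply_of_notMem hj, map_zero, DFinsupp.notMem_support_iff.1 hj]

theorem VectorField.apply_eq_sum {M : Supermanifold} (X : VectorField M) (s : Finset ℤ)
    (hs : ∀ j ∉ s, X j = 0) (U : Opens M.carrier) (a : M.sec U) :
    X.apply U a = ∑ j ∈ s, (X j).1 U a := by
  classical
  rw [VectorField.apply, DirectSum.coeLinearMap_eq_dfinsuppSum, DFinsupp.sum, Finset.sum_apply,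
    LinearMap.sum_apply]
  refine Finset.sum_subset (fun j hj => ?_) fun j _ hj => ?_
  · by_contra hjs
    exact DFinsupp.mem_support_iff.1 hj (hs j hjs)
  · rw [DFinsupp.notMem_support_iff.1 hj]
    rfl

/-- Vector fields are related exactly if their homogeneous components are. -/
theorem related_iff_components {M N : Supermanifold} (f : M ⟶ N) (X : VectorField M)
    (Y : VectorField N) : Related f X Y ↔ ∀ (j : ℤ) (q : OpenPair (Hom.base f)) (a : N.sec q.tgt),
      Hom.pull f q ((Y j).1 q.tgt a) = (X j).1 q.src (Hom.pull f q a) := by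
  classical
  have hX : ∀ j ∉ DFinsupp.support X ∪ DFinsupp.support Y, X j = 0 ∧ Y j = 0 := by
    intro j hj
    rwa [Finset.mem_union, not_or, DFinsupp.notMem_support_iff, DFinsupp.notMem_support_iff] at hj
  constructor
  · intro h j q a
    by_cases hj : j ∈ DFinsupp.support X ∪ DFinsupp.support Y
    · induction a using (N.isInternal q.tgt).induction_homogeneous with
      | hom i a ha =>
        have hs := h q a
        rw [Y.apply_eq_sum _ fun j hj => (hX j hj).2, X.apply_eq_sum _ fun j hj => (hX j hj).1,
          map_sum] at hs
        exact (M.isInternal q.src).eq_of_sum_eq _ _ _ i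
          (fun j => Hom.pull_deg f q _ _ ((Y j).2.2.1 q.tgt i a ha))
          (fun j => (X j).2.2.1 q.src i _ (Hom.pull_deg f q i a ha)) hs j hj
      | add a b ha hb => simp only [map_add, ha, hb]
    · rw [(hX j hj).1, (hX j hj).2]
      exact map_zero (Hom.pull f q)
  · intro h q a
    rw [Y.apply_eq_sum _ fun j hj => (hX j hj).2, X.apply_eq_sum _ fun j hj => (hX j hj).1, map_sum]
    exact Finset.sum_congr rfl fun j _ => h j q a

theorem related_iff_toPoint {M N : Supermanifold} (f : M ⟶ N) (X : VectorField M)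
    (Y : VectorField N) : Related f X Y ↔ X.toPoint.postcomp f = Y.toPoint.precomp f := by
  have hpost : ∀ (j : ℤ) (V : Opens N.carrier) (U : Opens M.carrier)
      (h : ∀ x ∈ U, Hom.base f x ∈ V) (a : N.sec V),
      ((X.toPoint.postcomp f).vec j).1 ⟨V, U, h⟩ a =
        (X j).1 U (Hom.pull f ⟨V, U, h⟩ a) := by
    intro j V U h a
    refine ((X j).2.1 U (Opens.comap (Hom.base f) V) (fun x hx => h x hx)
      (Hom.pull f (OpenPair.full _ V) a)).symm.trans ?_
    exact congrArg ((X j).1 U) (Hom.res_pull f _ _ h a)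
  have hpre : ∀ (j : ℤ) (V : Opens N.carrier) (U : Opens M.carrier)
      (h : ∀ x ∈ U, Hom.base f x ∈ V) (a : N.sec V),
      ((Y.toPoint.precomp f).vec j).1 ⟨V, U, h⟩ a =
        Hom.pull f ⟨V, U, h⟩ ((Y j).1 V a) := fun j V U h a =>
    Hom.pull_res_left f _ _ h _
  rw [related_iff_components]
  constructor
  · intro h
    refine TangentPoint.ext' ((Category.id_comp f).trans (Category.comp_id f).symm)
      fun j V U hV hV' a => ?_
    exact (hpost j V U hV a).trans ((h j ⟨V, U, hV⟩ a).symm.trans (hpre j V U hV a).symm)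
  · intro h j q a
    exact (hpre j q.tgt q.src q.le a).symm.trans
      ((TangentPoint.congr_apply h j q.tgt q.src q.le q.le a).symm.trans
        (hpost j q.tgt q.src q.le a))

/-- Relatedness is compatibility of the sections with the tangent map. -/
theorem related_iff_toSection {M N : Supermanifold} (f : M ⟶ N) (X : VectorField M)
    (Y : VectorField N) : Related f X Y ↔
      X.toSection ≫ tangentFunctor.map f = yoneda.map f ≫ Y.toSection := by
  rw [related_iff_toPoint]
  have h1 : X.toSection ≫ tangentFunctor.map f =
      yonedaEquiv.symm (show (tangentFunctor.obj N).obj (op M) from X.toPoint.postcomp f) :=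
    yonedaEquiv_symm_naturality_right M (tangentFunctor.map f) X.toPoint
  have h2 : yoneda.map f ≫ Y.toSection =
      yonedaEquiv.symm (show (tangentFunctor.obj N).obj (op M) from Y.toPoint.precomp f) :=
    yonedaEquiv_symm_naturality_left f (tangentFunctor.obj N) Y.toPoint
  rw [h1, h2]
  exact (yonedaEquiv (F := tangentFunctor.obj N)).symm.injective.eq_iff.symm

end Supermanifold

/-! ### Multiplicative vector fields -/

namespace Supergroupoid

open Supermanifold

theorem isGroupoid_points (𝒢 : Supergroupoid) : 𝒢.points.IsGroupoid :=
  𝒢.isGroupoid.map yoneda (𝒢.isGroupoid.isPullback.map yoneda) fun S _ _ _ h =>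
    h S.unop (fun _ z => z) fun _ _ _ _ => rfl

theorem isGroupoid_tangent (𝒢 : Supergroupoid) : 𝒢.tangent.IsGroupoid :=
  𝒢.isGroupoid.map tangentFunctor (isPullback_tangentFunctor_map 𝒢.isGroupoid.isPullback)
    fun _ _ x y h => TangentPoint.eq_of_natural x y h

end Supergroupoid

end

theorem mainTheorem2 (𝒢 : Supergroupoid) :
    ∃ hT : 𝒢.tangent.IsGroupoid,
      ∀ ψ : Supermanifold.VectorField 𝒢.mor,
        𝒢.IsMultiplicative ψ ↔ 𝒢.points.IsMorphism 𝒢.tangent hT ψ.toSection := by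
  refine ⟨𝒢.isGroupoid_tangent, fun ψ => ⟨?_, ?_⟩⟩
  · rintro ⟨ψ₂, h₁, h₂, hm⟩
    rw [Supermanifold.related_iff_toSection] at h₁ h₂ hm
    exact GroupoidData.IsGroupoid.isMorphism_of_comp (H := 𝒢.tangent) 𝒢.isGroupoid_points
      𝒢.isGroupoid_tangent ψ.toSection ψ₂.toSection h₁ h₂ hm
  · intro hψ
    obtain ⟨L, h₁, h₂, hm⟩ := 𝒢.isGroupoid_tangent.exists_comp_of_isMorphism hψ
    obtain ⟨x, rfl⟩ := (yonedaEquiv (X := 𝒢.comp)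
      (F := Supermanifold.tangentFunctor.obj 𝒢.comp)).symm.surjective L
    have hpt : ∀ {p : 𝒢.comp ⟶ 𝒢.mor},
        yonedaEquiv.symm x ≫ Supermanifold.tangentFunctor.map p = yoneda.map p ≫ ψ.toSection →
          Supermanifold.TangentPoint.pt x ≫ p = p := by
      intro p hp
      have h3 := (yonedaEquiv_symm_naturality_right _ (Supermanifold.tangentFunctor.map p) x).symm
      have h4 := yonedaEquiv_symm_naturality_left p (Supermanifold.tangentFunctor.obj 𝒢.mor)
        ψ.toPoint
      have h5 := yonedaEquiv.symm.injective (h3.trans (hp.trans h4))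
      exact (congrArg Supermanifold.TangentPoint.pt h5).trans (Category.comp_id p)
    obtain ⟨ψ₂, rfl⟩ := Supermanifold.VectorField.exists_toPoint_eq x
      (𝒢.isGroupoid.isPullback.hom_ext ((hpt h₁).trans (Category.id_comp _).symm)
        ((hpt h₂).trans (Category.id_comp _).symm))
    exact ⟨ψ₂, (Supermanifold.related_iff_toSection _ _ _).2 h₁,
      (Supermanifold.related_iff_toSection _ _ _).2 h₂,
      (Supermanifold.related_iff_toSection _ _ _).2 hm⟩
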